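/- Let $\mathbb{C}_+=\{x+iy : y>0\}$. A growth function is a continuous nondecreasing function $\Phi$ from $[0,\infty)$ onto itself. It satisfies the $\Delta_2$-condition if there is $K>1$ with $\Phi(2t)\le K\Phi(t)$ for all $t\ge 0$. A convex growth function $\Phi$ satisfies the $\nabla_2$-condition if both $\Phi$ and its complementary function $\Psi(s)=\sup_{t\ge 0}\{ts-\Phi(t)\}$ satisfy the $\Delta_2$-condition. A growth function $\Phi$ belongs to $\mathscr{U}$ if $t\mapsto \Phi(t)/t$ is nondecreasing on $(0,\infty)$ and there are $q\ge 1$ and $C>0$ with $\Phi(st)\le Ct^q\Phi(s)$ for all $s>0$, $t\ge 1$. For a measure $\nu$ and a measurable function $g$ put $$\|g\|_{L^\Phi(\nu)}^{lux}=\inf\Big\{\lambda>0:\ \int \Phi\big(|g|/\lambda\big)\,d\nu\le 1\Big\}$$ (with $\inf\emptyset=\infty$). The Hardy–Orlicz space $H^\Phi(\mathbb{C}_+)$ consists of the holomorphic functions $f$ on $\mathbb{C}_+$ with $$\|f\|_{H^\Phi}^{lux}=\sup_{y>0}\|f(\cdot+iy)\|_{L^\Phi(\mathbb{R},dx)}^{lux}<\infty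 .$$ For an interval $I\subset\mathbb{R}$ of finite positive length $|I|$ let $Q_I=\{x+iy: x\in I,\ 0<y<|I|\}$. **Theorem.** Let $\Phi_1,\Phi_2$ be two $\mathcal{C}^1$ convex growth functions with $\Phi_2\in\mathscr{U}$. Assume that $\Phi_1$ satisfies the $\nabla_2$-condition and that $\Phi_2/\Phi_1$ is nondecreasing on $(0,\infty)$. Let $\mu$ be a positive Borel measure on $\mathbb{C}_+$. Then the following assertions are equivalent. (a) $\mu$ is a $\Phi_2\circ\Phi_1^{-1}$-Carleson measure: there is a constant $C>0$ such that for every interval $I\subset\mathbb{R}$ of finite positive length, $$\mu(Q_I)\le \frac{C}{\Phi_2\circ\Phi_1^{-1}(1/|I|)} .$$ (b) There is a constant $C>0$ such that $$\sup_{z=x+iy\in\mathbb{C}_+}\int_{\mathbb{C}_+}\Phi_2\left(\Phi_1^{-1}\left(\frac1y\right)\frac{y^2}{|z-\bar w|^2}\right)d\mu(w)\le C<\infty .$$ (c) There is a constant $K>0$ such that for every $f\in H^{\Phi_1}(\mathbb{C}_+)$, $f\ne 0$, $$\int_{\mathbb{C}_+}\Phi_2\left(\frac{|f(z)|}{K\|f\|_{H^{\Phi_1}}^{lux}}\right)d\mu(z)<\infty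 .$$ (d) $H^{\Phi_1}(\mathbb{C}_+)$ embeds continuously into $L^{\Phi_2}(\mathbb{C}_+,d\mu)$: there is a constant $K>0$ such that for every $f\in H^{\Phi_1}(\mathbb{C}_+)$, $$\|f\|_{L^{\Phi_2}(\mu)}^{lux}\le K\|f\|_{H^{\Phi_1}}^{lux} .$$ -/

import Mathlib

open MeasureTheory Set

noncomputable section

/-- A growth function: a continuous nondecreasing function from `[0, ∞)` onto itself.
It is represented by a function on `ℝ` of which only the values on `[0, ∞)` are used. -/
structure IsGrowthFunction (Φ : ℝ → ℝ) : Prop where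
  continuousOn : ContinuousOn Φ (Ici 0)
  monotoneOn : MonotoneOn Φ (Ici 0)
  image_eq : Φ '' Ici 0 = Ici 0

/-- A convex growth function which is continuously differentiable on `[0, ∞)`
(one-sided derivative at `0`). -/
structure IsC1ConvexGrowthFunction (Φ : ℝ → ℝ) : Prop where
  isGrowthFunction : IsGrowthFunction Φ
  convexOn : ConvexOn ℝ (Ici 0) Φ
  contDiffOn : ContDiffOn ℝ 1 Φ (Ici 0)

/-- Upper type `q`: `Φ (s t) ≤ C t ^ q Φ s` for all `s > 0` and `t ≥ 1`. -/
def IsUpperType (Φ : ℝ → ℝ) (q : ℝ) : Prop :=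
  ∃ C : ℝ, 0 < C ∧ ∀ s t : ℝ, 0 < s → 1 ≤ t → Φ (s * t) ≤ C * t ^ q * Φ s

/-- The class `𝒰`, the union over `q ≥ 1` of the classes of growth functions of upper type `q`
for which `Φ t / t` is nondecreasing. -/
def IsClassU (Φ : ℝ → ℝ) : Prop :=
  ∃ q : ℝ, 1 ≤ q ∧ IsGrowthFunction Φ ∧ IsUpperType Φ q ∧
    MonotoneOn (fun t => Φ t / t) (Ioi 0)

/-- The complementary function `Ψ s = sup_{t ≥ 0} (t s - Φ t)`, with values in `[0, ∞]`. When
`Φ 0 = 0` the supremum is at least `0`, so that truncating the terms at `0` changes nothing. -/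
def complementary (Φ : ℝ → ℝ) (s : ℝ) : ENNReal :=
  ⨆ t ∈ Ici (0 : ℝ), ENNReal.ofReal (t * s - Φ t)

/-- The `Δ₂`-condition `Φ (2 t) ≤ K Φ t`, for `[0, ∞]`-valued functions. -/
def DeltaTwo (Φ : ℝ → ENNReal) : Prop :=
  ∃ K : ℝ, 1 < K ∧ ∀ t : ℝ, 0 ≤ t → Φ (2 * t) ≤ ENNReal.ofReal K * Φ t

/-- The `∇₂`-condition: `Φ` and its complementary function satisfy the `Δ₂`-condition. -/
def NablaTwo (Φ : ℝ → ℝ) : Prop :=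
  DeltaTwo (fun t => ENNReal.ofReal (Φ t)) ∧ DeltaTwo (complementary Φ)

/-- The inverse on `[0, ∞)` of a function that maps `[0, ∞)` bijectively onto itself. -/
def growthInv (Φ : ℝ → ℝ) : ℝ → ℝ :=
  Function.invFunOn Φ (Ici 0)

/-- The Carleson square `Q_I = {x + i y : x ∈ I, 0 < y < |I|}` in the upper half-plane. -/
def carlesonSquare (I : Set ℝ) : Set UpperHalfPlane :=
  {z | z.re ∈ I ∧ z.im < volume.real I}

/-- `μ` is a `Φ`-Carleson measure: `μ (Q_I) ≤ C / Φ (1 / |I|)` for every finite interval `I`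
(of positive length; open, closed or half-open). -/
def IsCarlesonMeasure (Φ : ℝ → ℝ) (μ : Measure UpperHalfPlane) : Prop :=
  ∃ C : ℝ, 0 < C ∧ ∀ I : Set ℝ, I.OrdConnected → Bornology.IsBounded I → 0 < volume.real I →
    μ (carlesonSquare I) ≤ ENNReal.ofReal (C / Φ (1 / volume.real I))

/-- The Luxembourg (quasi)-norm on `L^Φ(ν)`,
`inf {l > 0 : ∫ Φ (|g| / l) dν ≤ 1}`, with value `∞` if there is no such `l`. -/
def luxNorm {α : Type*} [MeasurableSpace α] (Φ : ℝ → ℝ) (ν : Measure α) (g : α → ℂ) : ENNReal :=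
  ⨅ (l : ℝ) (_ : 0 < l) (_ : ∫⁻ x, ENNReal.ofReal (Φ (‖g x‖ / l)) ∂ν ≤ 1), ENNReal.ofReal l

/-- The Hardy–Orlicz (quasi)-norm `sup_{y > 0} ‖f (· + i y)‖_{L^Φ(ℝ)}`. -/
def hardyNorm (Φ : ℝ → ℝ) (f : ℂ → ℂ) : ENNReal :=
  ⨆ y ∈ Ioi (0 : ℝ), luxNorm Φ (volume : Measure ℝ) (fun x : ℝ => f (x + y * Complex.I))

/-- Membership in the Hardy–Orlicz space of the upper half-plane; only the values of `f` on the
upper half-plane are used. -/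
def MemHardyOrlicz (Φ : ℝ → ℝ) (f : ℂ → ℂ) : Prop :=
  DifferentiableOn ℂ f {z : ℂ | 0 < z.im} ∧ hardyNorm Φ f < ⊤

end

/-!
The four assertions are linked by the cycle Carleson condition → embedding → bounded test
integrals → Carleson condition, and by embedding → finite modulars → Carleson condition.

*What the hypotheses give.* Both functions are convex and doubling. Doubling of the
complementary function of `Φ₁` gives the Dini condition `∑ₖ 2ᵏ Φ₁ (2⁻ᵏ t) ≤ D Φ₁ t`
(`exists_isDini`), by the equality case of Young's inequality. The monotonicity of
`Φ₂ / Φ₁` says that `W s = 1 / Φ₂ (Φ₁⁻¹ (1 / s))` has `W s / s` nondecreasing, so that Carleson bounds over disjoint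
intervals add up.

*Embedding.* A translate `f (· + i ε)` is bounded (`exists_norm_le_of_lintegral_le`) and therefore
dominated by the Poisson integral of its modulus `g` on the real line
(`ofReal_norm_le_lintegral_poisson`). Where this Poisson integral exceeds `32 m`, some
interval whose half-length is at least the height has average of `g` above `2 m`. Vitali's covering
lemma, applied to these intervals, bounds the `μ`-measure of the level set by a multiple of
`Φ₁ m / (m Φ₂ m) · ∫_{g > m} g` (`measure_le_of_forall_exists_interval`); summing over dyadic `m`
and using the Dini condition gives `∫ Φ₂ (|f (· + i ε)|) dμ ≤ B` for normalized `f`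
(`exists_lintegral_le_of_poisson`). This merges the weak-type estimate for the
maximal function with the Carleson estimate, and no boundary values of `f` are needed: Fatou's lemma lets `ε → 0`.

*Necessity.* The functions `Φ₁⁻¹(1 / y) · i y / (w - conj z)` have bounded norm by the Dini
condition, and they dominate the integrand of the test integrals. They also have positive real
part, so that a series of them does not cancel: if the Carleson condition failed, a suitable series
would have infinite modular at any prescribed dilation
(`isCarlesonMeasure_of_forall_lintegral_lt_top`).
-/

noncomputable section

/-! ### Convex doubling growth functions -/

/-- A convex growth function with the doubling property `Φ (2 t) ≤ K Φ t`. Both functions of the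
theorem are of this kind. -/
structure IsDoublingConvex (Φ : ℝ → ℝ) : Prop where
  isGrowthFunction : IsGrowthFunction Φ
  convexOn : ConvexOn ℝ (Ici 0) Φ
  doubling : ∃ K : ℝ, ∀ t : ℝ, 0 ≤ t → Φ (2 * t) ≤ K * Φ t

lemma IsGrowthFunction.nonneg {Φ : ℝ → ℝ} (h : IsGrowthFunction Φ) {t : ℝ} (ht : 0 ≤ t) :
    0 ≤ Φ t := by
  have : Φ t ∈ Φ '' Ici 0 := ⟨t, ht, rfl⟩
  rw [h.image_eq] at this
  exact this

lemma IsGrowthFunction.map_zero {Φ : ℝ → ℝ} (h : IsGrowthFunction Φ) : Φ 0 = 0 := by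
  have : (0 : ℝ) ∈ Φ '' Ici 0 := by rw [h.image_eq]; exact self_mem_Ici
  obtain ⟨t, ht, h0⟩ := this
  exact le_antisymm (h0 ▸ h.monotoneOn self_mem_Ici ht ht) (h.nonneg le_rfl)

/-- The modular integrand `Φ (|g|)` is measurable when `g` is. -/
lemma IsGrowthFunction.measurable_comp {Φ : ℝ → ℝ} (h : IsGrowthFunction Φ) {α : Type*}
    [MeasurableSpace α] {g : α → ℝ} (hg : Measurable g) (h0 : ∀ x, 0 ≤ g x) :
    Measurable fun x => ENNReal.ofReal (Φ (g x)) := by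
  have h1 : Monotone fun t : ℝ => Φ (max t 0) := fun a b hab =>
    h.monotoneOn (mem_Ici.2 (le_max_right _ _)) (mem_Ici.2 (le_max_right _ _))
      (max_le_max_right _ hab)
  have h2 := (h1.measurable.comp hg).ennreal_ofReal
  convert h2 using 3 with x
  simp [max_eq_left (h0 x)]

namespace IsDoublingConvex

variable {Φ : ℝ → ℝ}

lemma nonneg (h : IsDoublingConvex Φ) {t : ℝ} (ht : 0 ≤ t) : 0 ≤ Φ t :=
  h.isGrowthFunction.nonneg ht

lemma map_zero (h : IsDoublingConvex Φ) : Φ 0 = 0 := h.isGrowthFunction.map_zero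

lemma mono (h : IsDoublingConvex Φ) {s t : ℝ} (hs : 0 ≤ s) (hst : s ≤ t) : Φ s ≤ Φ t :=
  h.isGrowthFunction.monotoneOn hs (hs.trans hst) hst

lemma map_mul_le (h : IsDoublingConvex Φ) {θ t : ℝ} (h0 : 0 ≤ θ) (h1 : θ ≤ 1) (ht : 0 ≤ t) :
    Φ (θ * t) ≤ θ * Φ t := by
  have := h.convexOn.2 (x := t) ht (y := 0) self_mem_Ici h0 (sub_nonneg.2 h1) (by ring)
  simpa [h.map_zero] using this

/-- `Φ t / t` is nondecreasing. -/
lemma map_mul_le_map_mul (h : IsDoublingConvex Φ) {s t : ℝ} (hs : 0 ≤ s) (hst : s ≤ t) :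
    Φ s * t ≤ Φ t * s := by
  rcases hs.eq_or_lt with rfl | hs'
  · simp [h.map_zero]
  have ht : 0 < t := hs'.trans_le hst
  have := h.map_mul_le (θ := s / t) (by positivity) ((div_le_one ht).2 hst) ht.le
  rw [div_mul_cancel₀ _ ht.ne', div_mul_eq_mul_div, le_div_iff₀ ht] at this
  linarith

lemma exists_map_two_pow_mul_le (h : IsDoublingConvex Φ) (n : ℕ) :
    ∃ D : ℝ, 1 ≤ D ∧ ∀ t, 0 ≤ t → Φ (2 ^ n * t) ≤ D * Φ t := by
  obtain ⟨K, hK⟩ := h.doubling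
  have hK' : ∀ t : ℝ, 0 ≤ t → Φ (2 * t) ≤ max K 1 * Φ t := fun t ht =>
    (hK t ht).trans (mul_le_mul_of_nonneg_right (le_max_left _ _) (h.nonneg ht))
  refine ⟨max K 1 ^ n, one_le_pow₀ (le_max_right _ _), ?_⟩
  induction n with
  | zero => simp
  | succ n ih =>
    intro t ht
    calc Φ (2 ^ (n + 1) * t) = Φ (2 * (2 ^ n * t)) := by ring_nf
      _ ≤ max K 1 * Φ (2 ^ n * t) := hK' _ (by positivity)
      _ ≤ max K 1 * (max K 1 ^ n * Φ t) := by
        gcongr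
        exact ih t ht
      _ = max K 1 ^ (n + 1) * Φ t := by ring

lemma exists_map_mul_le (h : IsDoublingConvex Φ) (A : ℝ) (hA : 0 ≤ A) :
    ∃ D : ℝ, 1 ≤ D ∧ ∀ t, 0 ≤ t → Φ (A * t) ≤ D * Φ t := by
  obtain ⟨n, hn⟩ := pow_unbounded_of_one_lt A (one_lt_two)
  obtain ⟨D, hD, h1⟩ := h.exists_map_two_pow_mul_le n
  exact ⟨D, hD, fun t ht => (h.mono (by positivity) (by gcongr)).trans (h1 t ht)⟩

lemma pos (h : IsDoublingConvex Φ) {t : ℝ} (ht : 0 < t) : 0 < Φ t := by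
  refine (h.nonneg ht.le).lt_of_ne fun h0 => ?_
  have : (1 : ℝ) ∈ Φ '' Ici 0 := by rw [h.isGrowthFunction.image_eq]; exact mem_Ici.2 zero_le_one
  obtain ⟨s, hs, h1⟩ := this
  rw [mem_Ici] at hs
  obtain ⟨D, -, hD⟩ := h.exists_map_mul_le (s / t) (by positivity)
  have := hD t ht.le
  rw [div_mul_cancel₀ _ ht.ne', h1, ← h0] at this
  linarith

lemma strictMonoOn (h : IsDoublingConvex Φ) : StrictMonoOn Φ (Ici 0) := by
  intro s hs t ht hst
  rw [mem_Ici] at hs ht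
  have h1 := h.map_mul_le_map_mul hs hst.le
  have h2 := h.pos (hs.trans_lt hst)
  nlinarith

lemma map_growthInv (h : IsDoublingConvex Φ) {t : ℝ} (ht : 0 ≤ t) : Φ (growthInv Φ t) = t :=
  Function.invFunOn_eq (by rw [← mem_Ici, ← h.isGrowthFunction.image_eq] at ht; exact ht)

lemma growthInv_nonneg (h : IsDoublingConvex Φ) {t : ℝ} (ht : 0 ≤ t) : 0 ≤ growthInv Φ t :=
  mem_Ici.1 (Function.invFunOn_mem (f := Φ) (b := t)
    (by rw [← mem_Ici, ← h.isGrowthFunction.image_eq] at ht; exact ht))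

lemma le_growthInv_iff (h : IsDoublingConvex Φ) {s t : ℝ} (hs : 0 ≤ s) (ht : 0 ≤ t) :
    s ≤ growthInv Φ t ↔ Φ s ≤ t := by
  rw [← h.strictMonoOn.le_iff_le hs (h.growthInv_nonneg ht), h.map_growthInv ht]

lemma growthInv_pos (h : IsDoublingConvex Φ) {t : ℝ} (ht : 0 < t) : 0 < growthInv Φ t := by
  refine (h.growthInv_nonneg ht.le).lt_of_ne fun h0 => ?_
  have := h.map_growthInv ht.le
  rw [← h0, h.map_zero] at this
  exact ht.ne this

lemma growthInv_mono (h : IsDoublingConvex Φ) {s t : ℝ} (hs : 0 ≤ s) (hst : s ≤ t) :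
    growthInv Φ s ≤ growthInv Φ t := by
  rw [h.le_growthInv_iff (h.growthInv_nonneg hs) (hs.trans hst), h.map_growthInv hs]
  exact hst

/-- `growthInv Φ t / t` is nonincreasing. -/
lemma mul_growthInv_le (h : IsDoublingConvex Φ) {θ t : ℝ} (h0 : 0 ≤ θ) (h1 : θ ≤ 1)
    (ht : 0 ≤ t) : θ * growthInv Φ t ≤ growthInv Φ (θ * t) := by
  rw [h.le_growthInv_iff (mul_nonneg h0 (h.growthInv_nonneg ht)) (mul_nonneg h0 ht)]
  refine (h.map_mul_le h0 h1 (h.growthInv_nonneg ht)).trans_eq ?_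
  rw [h.map_growthInv ht]

/-- Countable Jensen inequality for the weights `2⁻¹, 2⁻², …`. -/
lemma map_tsum_le (h : IsDoublingConvex Φ) {a : ℕ → ℝ} (ha : ∀ n, 0 ≤ a n)
    (hs : Summable fun n => (1 / 2) ^ (n + 1) * a n) :
    ENNReal.ofReal (Φ (∑' n, (1 / 2) ^ (n + 1) * a n)) ≤
      ∑' n, ENNReal.ofReal ((1 / 2) ^ (n + 1)) * ENNReal.ofReal (Φ (a n)) := by
  have hw : ∀ m, ∑ n ∈ Finset.range m, (1 / 2 : ℝ) ^ (n + 1) = 1 - (1 / 2) ^ m := by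
    intro m
    induction m with
    | zero => simp
    | succ m ih => rw [Finset.sum_range_succ, ih]; ring
  have hp : ∀ n, 0 ≤ (1 / 2 : ℝ) ^ (n + 1) * a n := fun n => mul_nonneg (by positivity) (ha n)
  have hfin : ∀ m, Φ (∑ n ∈ Finset.range m, (1 / 2) ^ (n + 1) * a n) ≤
      ∑ n ∈ Finset.range m, (1 / 2) ^ (n + 1) * Φ (a n) := by
    intro m
    -- the missing weight `2⁻ᵐ` is put at the point `0`, where `Φ` vanishes
    have := h.convexOn.map_add_sum_le (t := Finset.range m) (w := fun n => (1 / 2 : ℝ) ^ (n + 1))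
      (p := a) (v := (1 / 2) ^ m) (q := 0) (fun _ _ => by positivity)
      (by rw [hw]; ring) (fun i _ => ha i) (by positivity) self_mem_Ici
    simpa [h.map_zero] using this
  have hlim : Filter.Tendsto (fun m => Φ (∑ n ∈ Finset.range m, (1 / 2) ^ (n + 1) * a n))
      Filter.atTop (nhds (Φ (∑' n, (1 / 2) ^ (n + 1) * a n))) := by
    refine ((h.isGrowthFunction.continuousOn _ (tsum_nonneg hp)).tendsto).comp
      (tendsto_nhdsWithin_iff.2 ⟨hs.hasSum.tendsto_sum_nat, ?_⟩)
    exact Filter.Eventually.of_forall fun m => Finset.sum_nonneg fun n _ => hp n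
  refine le_of_tendsto (ENNReal.tendsto_ofReal hlim) (Filter.Eventually.of_forall fun m => ?_)
  refine (ENNReal.ofReal_le_ofReal (hfin m)).trans ?_
  rw [ENNReal.ofReal_sum_of_nonneg fun n _ => mul_nonneg (by positivity) (h.nonneg (ha n))]
  simp_rw [ENNReal.ofReal_mul (show (0 : ℝ) ≤ (1 / 2) ^ (_ + 1) by positivity)]
  exact ENNReal.sum_le_tsum _

end IsDoublingConvex

lemma IsC1ConvexGrowthFunction.isDoublingConvex_of_isClassU {Φ : ℝ → ℝ}
    (h : IsC1ConvexGrowthFunction Φ) (hU : IsClassU Φ) : IsDoublingConvex Φ := by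
  obtain ⟨q, -, -, ⟨C, -, hC⟩, -⟩ := hU
  refine ⟨h.isGrowthFunction, h.convexOn, C * 2 ^ q, fun t ht => ?_⟩
  rcases ht.eq_or_lt with rfl | ht
  · simp [h.isGrowthFunction.map_zero]
  · rw [mul_comm 2 t]
    exact hC t 2 ht one_le_two

lemma IsC1ConvexGrowthFunction.isDoublingConvex_of_nablaTwo {Φ : ℝ → ℝ}
    (h : IsC1ConvexGrowthFunction Φ) (hN : NablaTwo Φ) : IsDoublingConvex Φ := by
  obtain ⟨K, hK, hD⟩ := hN.1
  refine ⟨h.isGrowthFunction, h.convexOn, K, fun t ht => ?_⟩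
  have := hD t ht
  rw [← ENNReal.ofReal_mul (by linarith)] at this
  exact (ENNReal.ofReal_le_ofReal_iff (mul_nonneg (by linarith)
    (h.isGrowthFunction.nonneg ht))).1 this

/-! ### The `∇₂`-condition and the Dini condition -/

/-- A convex function on `[0, ∞)` has a supporting line at each point `t > 0`. -/
lemma exists_supporting_slope {Φ : ℝ → ℝ} (h : ConvexOn ℝ (Ici 0) Φ) {t : ℝ} (ht : 0 < t) :
    ∃ s : ℝ, ∀ u, 0 ≤ u → Φ t + s * (u - t) ≤ Φ u := by
  have hi : t ∈ interior (Ici (0 : ℝ)) := by rw [interior_Ici]; exact ht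
  refine ⟨derivWithin Φ (Ioi t) t, fun u hu => ?_⟩
  rcases lt_trichotomy u t with hut | rfl | hut
  · have h1 := h.slope_le_leftDeriv_of_mem_interior hu hi hut
    have h2 := h.leftDeriv_le_rightDeriv_of_mem_interior hi
    have h3 := h1.trans h2
    rw [slope_def_field, div_le_iff₀ (by linarith)] at h3
    linarith
  · simp
  · have h1 := h.rightDeriv_le_slope_of_mem_interior hi hu hut
    rw [slope_def_field, le_div_iff₀ (by linarith)] at h1
    linarith

/-- If the complementary function is doubling, then `Φ` grows faster than linearly by a definite
factor. At a point `t` with supporting slope `s` Young's inequality is an equality,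
`Ψ s = t s - Φ t`, and testing it at the pair `(2 ^ N t, 2 s)` gives the bound when
`K ≤ 2 ^ (N + 1)`. -/
lemma exists_two_pow_mul_map_le {Φ : ℝ → ℝ} (h : IsDoublingConvex Φ)
    (hN : DeltaTwo (complementary Φ)) :
    ∃ N : ℕ, ∀ t, 0 ≤ t → 2 ^ (N + 1) * Φ t ≤ Φ (2 ^ N * t) := by
  obtain ⟨K, hK1, hK⟩ := hN
  obtain ⟨N, hN⟩ := pow_unbounded_of_one_lt K one_lt_two
  refine ⟨N, fun t ht => ?_⟩
  rcases ht.eq_or_lt with rfl | ht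
  · simp [h.map_zero]
  obtain ⟨s, hs⟩ := exists_supporting_slope h.convexOn ht
  have hs0 : 0 ≤ t * s - Φ t := by
    have := hs 0 le_rfl
    rw [h.map_zero] at this
    linarith
  have hspos : 0 ≤ s := by
    by_contra! hneg
    nlinarith [h.nonneg ht.le]
  have hΨ : complementary Φ s ≤ ENNReal.ofReal (t * s - Φ t) :=
    iSup₂_le fun u hu => ENNReal.ofReal_le_ofReal (by linarith [hs u hu])
  have h2 : ENNReal.ofReal (2 ^ N * t * (2 * s) - Φ (2 ^ N * t)) ≤
      ENNReal.ofReal (K * (t * s - Φ t)) := by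
    refine (le_iSup₂_of_le (f := fun (t : ℝ) (_ : t ∈ Ici (0 : ℝ)) =>
      ENNReal.ofReal (t * (2 * s) - Φ t)) (2 ^ N * t) (mem_Ici.2 (by positivity)) le_rfl).trans ?_
    refine (hK s hspos).trans ?_
    rw [ENNReal.ofReal_mul (by linarith)]
    gcongr
  rw [ENNReal.ofReal_le_ofReal_iff (mul_nonneg (by linarith) hs0)] at h2
  have h3 : K * (t * s - Φ t) ≤ 2 ^ (N + 1) * (t * s - Φ t) := by
    refine mul_le_mul_of_nonneg_right (hN.le.trans ?_) hs0
    exact pow_le_pow_right₀ one_le_two (Nat.le_succ N)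
  have e : (2 : ℝ) ^ (N + 1) = 2 * 2 ^ N := by ring
  rw [e] at h3 ⊢
  nlinarith

/-- The Dini condition `∑ₖ 2ᵏ Φ (2⁻ᵏ t) ≤ D Φ t`, a discrete form of
`∫₀ᵗ Φ(s) / s² ds ≤ D Φ(t) / t`. -/
def IsDini (Φ : ℝ → ℝ) (D : ℝ) : Prop :=
  ∀ t, 0 ≤ t → ∑' k : ℕ, ENNReal.ofReal (2 ^ k * Φ ((1 / 2) ^ k * t)) ≤ ENNReal.ofReal (D * Φ t)

lemma exists_isDini {Φ : ℝ → ℝ} (h : IsDoublingConvex Φ) (hN : DeltaTwo (complementary Φ)) :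
    ∃ D : ℝ, 1 ≤ D ∧ IsDini Φ D := by
  obtain ⟨N, hN⟩ := exists_two_pow_mul_map_le h hN
  refine ⟨2 * N + 1, by linarith [Nat.cast_nonneg (α := ℝ) N], fun t ht => ?_⟩
  set b : ℕ → ℝ := fun k => 2 ^ k * Φ ((1 / 2) ^ k * t) with hb
  have hb0 : ∀ k, 0 ≤ b k := fun k => mul_nonneg (by positivity) (h.nonneg (by positivity))
  have hanti : Antitone b := by
    refine antitone_nat_of_succ_le fun k => ?_
    have := h.map_mul_le (θ := 1 / 2) (t := (1 / 2) ^ k * t) (by norm_num) (by norm_num)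
      (by positivity)
    calc b (k + 1) = 2 ^ (k + 1) * Φ (1 / 2 * ((1 / 2) ^ k * t)) := by
          simp only [hb]; ring_nf
      _ ≤ 2 ^ (k + 1) * (1 / 2 * Φ ((1 / 2) ^ k * t)) := by gcongr
      _ = b k := by simp only [hb]; ring
  -- after `N` steps the terms have been halved
  have hhalf : ∀ k, b (k + N) ≤ b k / 2 := by
    intro k
    have := hN ((1 / 2) ^ (k + N) * t) (by positivity)
    have e : (2 : ℝ) ^ N * ((1 / 2) ^ (k + N) * t) = (1 / 2) ^ k * t := by
      rw [pow_add, ← mul_assoc, mul_comm ((1 / 2 : ℝ) ^ k), ← mul_assoc, ← mul_pow]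
      norm_num
    rw [e] at this
    have h2 : (2 : ℝ) ^ k * (2 ^ (N + 1) * Φ ((1 / 2) ^ (k + N) * t)) ≤
      2 ^ k * Φ ((1 / 2) ^ k * t) := by gcongr
    have e2 : (2 : ℝ) ^ k * (2 ^ (N + 1) * Φ ((1 / 2) ^ (k + N) * t)) = 2 * b (k + N) := by
      simp only [hb]; ring
    rw [e2] at h2
    simp only [hb] at h2 ⊢
    linarith
  have hsum : ∀ n, ∑ k ∈ Finset.range n, b k ≤ (2 * N + 1) * Φ t := by
    intro n
    have h1 : ∑ k ∈ Finset.range n, b k ≤ ∑ k ∈ Finset.range (N + n), b k :=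
      Finset.sum_le_sum_of_subset_of_nonneg (Finset.range_mono (by lia)) fun _ _ _ => hb0 _
    rw [Finset.sum_range_add] at h1
    have h2 : ∑ k ∈ Finset.range N, b k ≤ N * Φ t := by
      have := Finset.sum_le_card_nsmul (Finset.range N) b (Φ t) fun k _ => by
        simpa [hb] using hanti (Nat.zero_le k)
      simpa using this
    have h3 : ∑ k ∈ Finset.range n, b (N + k) ≤ (∑ k ∈ Finset.range n, b k) / 2 := by
      rw [Finset.sum_div]
      exact Finset.sum_le_sum fun k _ => by rw [add_comm]; exact hhalf k
    linarith [h.nonneg ht]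
  refine ENNReal.tsum_le_of_sum_range_le fun n => ?_
  rw [← ENNReal.ofReal_sum_of_nonneg fun k _ => hb0 k]
  exact ENNReal.ofReal_le_ofReal (hsum n)

/-! ### Poisson domination on the upper half-plane -/

open Filter Topology in
/-- A bounded holomorphic function on a neighbourhood of the closed upper half-plane is dominated
by the Poisson integral of its modulus on the real line. This follows from Cauchy's theorem for
`(G w - G z) / ((w - z) (w - conj z))`, whose decay like `|w|⁻²` makes the contributions of the
other three sides of large rectangles vanish. -/
theorem ofReal_norm_le_lintegral_poisson {G : ℂ → ℂ} {δ M : ℝ} (hδ : 0 < δ)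
    (hd : DifferentiableOn ℂ G {w | -δ < w.im}) (hM : ∀ w : ℂ, 0 ≤ w.im → ‖G w‖ ≤ M)
    {z : ℂ} (hz : 0 < z.im) :
    ENNReal.ofReal ‖G z‖ ≤
      ∫⁻ t : ℝ, ENNReal.ofReal (z.im / (Real.pi * ((t - z.re) ^ 2 + z.im ^ 2)) * ‖G t‖) := by
  set x := z.re with hx
  set y := z.im with hy
  have hM0 : 0 ≤ M := (norm_nonneg _).trans (hM z hz.le)
  set U : Set ℂ := {w | -min δ y < w.im} with hU
  have hUo : IsOpen U := isOpen_lt continuous_const Complex.continuous_im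
  have hmin : 0 < min δ y := lt_min hδ hz
  have hGU : DifferentiableOn ℂ G U := hd.mono fun w hw => by
    simp only [hU, mem_ofPred_eq] at hw ⊢
    linarith [min_le_left δ y]
  have hzU : z ∈ U := by simp only [hU, mem_ofPred_eq]; linarith
  set cz : ℂ := (starRingEnd ℂ) z with hcz
  have hne : ∀ w ∈ U, w - cz ≠ 0 := by
    intro w hw h0
    have := congrArg Complex.im h0
    simp only [hcz, Complex.sub_im, Complex.conj_im, Complex.zero_im, hU, mem_ofPred_eq] at this hw
    linarith [min_le_right δ y]
  set h : ℂ → ℂ := fun w => dslope G z w * (w - cz)⁻¹ with hh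
  have hdh : DifferentiableOn ℂ h U :=
    ((Complex.differentiableOn_dslope (hUo.mem_nhds hzU)).2 hGU).mul
      ((differentiableOn_id.sub_const _).inv hne)
  have hval : ∀ w : ℂ, w ≠ z → h w = (G w - G z) / ((w - z) * (w - cz)) := by
    intro w hw
    simp only [hh, dslope_of_ne _ hw, slope_def_field]
    rw [div_mul_eq_mul_div, ← div_eq_mul_inv, div_div, mul_comm]
  have hbd : ∀ (w : ℂ) (R : ℝ), 0 < R → 0 ≤ w.im → R / 2 ≤ ‖w - z‖ → R / 2 ≤ ‖w - cz‖ →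
      ‖h w‖ ≤ 8 * M / R ^ 2 := by
    intro w R hR hw h1 h2
    have hwz : w ≠ z := by
      rintro rfl
      simp at h1; linarith
    rw [hval w hwz, norm_div, norm_mul,
      div_le_div_iff₀ (mul_pos (by linarith) (by linarith)) (by positivity)]
    have h3 : ‖G w - G z‖ ≤ 2 * M := (norm_sub_le _ _).trans (by linarith [hM w hw, hM z hz.le])
    have h4 : R / 2 * (R / 2) ≤ ‖w - z‖ * ‖w - cz‖ := by gcongr
    calc ‖G w - G z‖ * R ^ 2 ≤ 2 * M * R ^ 2 := by gcongr
      _ = 8 * M * (R / 2 * (R / 2)) := by ring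
      _ ≤ _ := by gcongr
  have hline : ∀ t : ℝ, h t = (G t - G z) * (((t - x) ^ 2 + y ^ 2 : ℝ) : ℂ)⁻¹ := by
    intro t
    have : (t : ℂ) ≠ z := by
      intro h0
      have := congrArg Complex.im h0
      simp at this; linarith
    rw [hval t this, div_eq_mul_inv]
    congr 2
    apply Complex.ext <;> simp [hcz, ← hx, ← hy, pow_two]; ring
  set k : ℝ → ℝ := fun t => ((t - x) ^ 2 + y ^ 2)⁻¹ with hk
  have hk0 : ∀ t, 0 ≤ k t := fun t => by positivity
  have hkeq : ∀ t, k t = (y ^ 2)⁻¹ * (1 + ((t - x) / y) ^ 2)⁻¹ := fun t => by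
    simp only [hk]
    rw [← mul_inv]
    congr 1
    field_simp
    ring
  have hkint : Integrable k := by
    have := ((integrable_inv_one_add_sq.comp_div hz.ne').comp_sub_right x).const_mul (y ^ 2)⁻¹
    exact this.congr (Eventually.of_forall fun t => (hkeq t).symm)
  have hkval : ∫ t, k t = Real.pi / y := by
    simp_rw [hkeq]
    rw [integral_const_mul, integral_sub_right_eq_self (fun t => (1 + (t / y) ^ 2)⁻¹) x,
      Measure.integral_comp_div (fun t => (1 + t ^ 2)⁻¹) y, integral_univ_inv_one_add_sq,
      abs_of_pos hz, smul_eq_mul]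
    field_simp
  have hGc : Continuous fun t : ℝ => G t :=
    (hGU.continuousOn.comp_continuous Complex.continuous_ofReal fun t => by
      simpa [hU] using hmin)
  have hkG : Integrable fun t : ℝ => G t * (k t : ℂ) :=
    Integrable.bdd_mul (c := M) hkint.ofReal hGc.aestronglyMeasurable
      (Eventually.of_forall fun t => hM t (by simp))
  have hkz : Integrable fun t : ℝ => G z * (k t : ℂ) := hkint.ofReal.const_mul _
  have hhint : Integrable fun t : ℝ => h t := by
    refine (hkG.sub hkz).congr (Eventually.of_forall fun t => ?_)
    simp only [hline, hk, Pi.sub_apply]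
    push_cast
    ring
  -- the rectangle with base `[x - R, x + R]` and height `R`
  have hrect : ∀ R : ℝ, 2 * y ≤ R → ‖∫ t in (x - R)..(x + R), h t‖ ≤ 32 * M / R := by
    intro R hR
    have hR0 : 0 < R := by linarith
    have hC := Complex.integral_boundary_rect_eq_zero_of_differentiableOn h
      (⟨x - R, 0⟩ : ℂ) ⟨x + R, R⟩ (hdh.mono fun w hw => by
        have h2 := hw.2
        simp only [mem_preimage, uIcc_of_le hR0.le, mem_Icc] at h2
        simp only [hU, mem_ofPred_eq]
        linarith [h2.1])
    simp only [Complex.ofReal_zero, zero_mul, add_zero] at hC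
    have htop : ‖∫ t in (x - R)..(x + R), h (t + R * Complex.I)‖ ≤
        8 * M / R ^ 2 * |x + R - (x - R)| := by
      refine intervalIntegral.norm_integral_le_of_norm_le_const fun t _ => ?_
      refine hbd _ R hR0 (by simpa using hR0.le) ?_ ?_
      · refine le_trans ?_ (Complex.abs_im_le_norm _)
        refine le_trans ?_ (le_abs_self _)
        simp [← hy]; linarith
      · refine le_trans ?_ (Complex.abs_im_le_norm _)
        refine le_trans ?_ (le_abs_self _)
        simp [hcz, ← hy]; linarith
    have hside : ∀ a : ℝ, |a - x| = R →
        ‖∫ s in (0 : ℝ)..R, h (a + s * Complex.I)‖ ≤ 8 * M / R ^ 2 * |R - 0| := by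
      intro a ha
      refine intervalIntegral.norm_integral_le_of_norm_le_const fun s hs => ?_
      rw [uIoc_of_le hR0.le] at hs
      refine hbd _ R hR0 (by simpa using hs.1.le) ?_ ?_
      · refine le_trans ?_ (Complex.abs_re_le_norm _)
        simp [← hx, ha]; linarith
      · refine le_trans ?_ (Complex.abs_re_le_norm _)
        simp [hcz, ← hx, ha]; linarith
    have hr := hside (x + R) (by simp [abs_of_pos hR0])
    have hl := hside (x - R) (by simp [abs_of_pos hR0])
    have key : ∫ t in (x - R)..(x + R), h t =
        (∫ t in (x - R)..(x + R), h (t + R * Complex.I)) -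
        Complex.I * (∫ s in (0 : ℝ)..R, h ((x + R : ℝ) + s * Complex.I)) +
        Complex.I * (∫ s in (0 : ℝ)..R, h ((x - R : ℝ) + s * Complex.I)) := by
      simp only [smul_eq_mul] at hC
      linear_combination hC
    rw [key]
    refine (norm_add_le _ _).trans ((add_le_add_left (norm_sub_le _ _) _).trans ?_)
    rw [norm_mul, norm_mul, Complex.norm_I, one_mul, one_mul]
    refine (add_le_add (add_le_add htop hr) hl).trans (le_of_eq ?_)
    rw [abs_of_pos (by linarith), abs_of_pos (by linarith)]
    field_simp
    ring
  have hzero : ∫ t : ℝ, h t = 0 := by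
    have h1 : Tendsto (fun R : ℝ => ∫ t in (x - R)..(x + R), h t) atTop (𝓝 (∫ t : ℝ, h t)) :=
      intervalIntegral_tendsto_integral hhint
        ((tendsto_atBot_add_const_left atTop x tendsto_neg_atTop_atBot).congr fun R =>
          (sub_eq_add_neg x R).symm)
        (tendsto_atTop_add_const_left _ x tendsto_id)
    refine tendsto_nhds_unique h1 (squeeze_zero_norm' ?_
      (tendsto_const_nhds (x := 32 * M) |>.div_atTop tendsto_id))
    filter_upwards [eventually_ge_atTop (2 * y)] with R hR using hrect R hR
  have hGz : G z * ((Real.pi / y : ℝ) : ℂ) = ∫ t : ℝ, G t * (k t : ℂ) := by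
    have : ∫ t : ℝ, h t = (∫ t : ℝ, G t * (k t : ℂ)) - ∫ t : ℝ, G z * (k t : ℂ) := by
      rw [← integral_sub hkG hkz]
      refine integral_congr_ae (Eventually.of_forall fun t => ?_)
      simp only [hline, hk]
      push_cast
      ring
    rw [hzero, integral_const_mul, integral_complex_ofReal, hkval] at this
    exact (sub_eq_zero.1 this.symm).symm
  have hnorm : ‖G z‖ * (Real.pi / y) ≤ ∫ t : ℝ, k t * ‖G t‖ := by
    have := norm_integral_le_integral_norm (μ := volume) fun t : ℝ => G t * (k t : ℂ)
    rw [← hGz, norm_mul, Complex.norm_real, Real.norm_of_nonneg (by positivity)] at this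
    refine this.trans_eq (integral_congr_ae (Eventually.of_forall fun t => ?_))
    simp only [norm_mul, Complex.norm_real, Real.norm_of_nonneg (hk0 t)]
    ring
  have hkn : Integrable fun t : ℝ => k t * ‖G t‖ := by
    refine hkG.norm.congr (Eventually.of_forall fun t => ?_)
    simp only [norm_mul, Complex.norm_real, Real.norm_of_nonneg (hk0 t)]
    ring
  have hpi := Real.pi_pos
  have hfin : ‖G z‖ ≤ ∫ t : ℝ, y / (Real.pi * ((t - x) ^ 2 + y ^ 2)) * ‖G t‖ := by
    have e : ∀ t : ℝ, y / (Real.pi * ((t - x) ^ 2 + y ^ 2)) * ‖G t‖ =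
        y / Real.pi * (k t * ‖G t‖) := fun t => by
      simp only [hk]
      rw [← div_div, div_eq_mul_inv (y / Real.pi)]
      ring
    simp_rw [e]
    rw [integral_const_mul]
    calc ‖G z‖ = y / Real.pi * (‖G z‖ * (Real.pi / y)) := by field_simp
      _ ≤ _ := by gcongr
  refine (ENNReal.ofReal_le_ofReal hfin).trans ?_
  refine (ofReal_integral_eq_lintegral_ofReal ?_ (Eventually.of_forall fun t => ?_)).le
  · refine (hkn.const_mul (y / Real.pi)).congr (Eventually.of_forall fun t => ?_)
    simp only [hk]
    rw [← div_div, div_eq_mul_inv (y / Real.pi)]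
    ring
  · exact mul_nonneg (by positivity) (norm_nonneg _)

/-! ### Boundedness on smaller half-planes -/

/-- Area mean value inequality on discs. -/
lemma ofReal_norm_mul_le_lintegral_ball {f : ℂ → ℂ} {c : ℂ} {r : ℝ} (hr : 0 < r)
    (hf : DifferentiableOn ℂ f (Metric.ball c r)) (hm : Measurable f) :
    ENNReal.ofReal (Real.pi * r ^ 2 * ‖f c‖) ≤
      ∫⁻ w in Metric.ball c r, ENNReal.ofReal ‖f w‖ := by
  set F : ℂ → ENNReal := fun w => (Metric.ball (0 : ℂ) r).indicator
    (fun w => ENNReal.ofReal ‖f (c + w)‖) w with hF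
  have hFm : Measurable F := by
    refine Measurable.indicator ?_ Metric.isOpen_ball.measurableSet
    fun_prop
  have hshift : ∫⁻ w in Metric.ball c r, ENNReal.ofReal ‖f w‖ = ∫⁻ w, F w := by
    rw [← lintegral_indicator Metric.isOpen_ball.measurableSet,
      ← lintegral_add_left_eq_self _ c]
    refine lintegral_congr fun w => ?_
    simp only [hF, indicator, Metric.mem_ball, dist_self_add_left, dist_zero_right]
  rw [hshift, ← Complex.lintegral_comp_polarCoord_symm, polarCoord_target, Measure.volume_eq_prod,
    ← Measure.prod_restrict, lintegral_prod _ (by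
      refine Measurable.aemeasurable ?_
      simp only [Complex.polarCoord_symm_apply]
      fun_prop)]
  have hpi := Real.pi_pos
  have hinner : ∀ ρ ∈ Ioo 0 r, ENNReal.ofReal (2 * Real.pi * ‖f c‖ * ρ) ≤
      ∫⁻ θ in Ioo (-Real.pi) Real.pi,
        ENNReal.ofReal ρ • F (Complex.polarCoord.symm (ρ, θ)) := by
    intro ρ hρ
    have hsub : Metric.closedBall c ρ ⊆ Metric.ball c r := Metric.closedBall_subset_ball hρ.2
    have hmean := DiffContOnCl.circleAverage (R := ρ) (f := f) (c := c) (by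
      rw [abs_of_pos hρ.1]
      exact (hf.mono hsub).diffContOnCl_ball subset_rfl)
    have hcont : Continuous fun θ => f (circleMap c ρ θ) :=
      hf.continuousOn.comp_continuous (continuous_circleMap c ρ) fun θ =>
        hsub (circleMap_mem_closedBall c hρ.1.le θ)
    have h1 : 2 * Real.pi * ‖f c‖ ≤ ∫ θ in (-Real.pi)..Real.pi, ‖f (circleMap c ρ θ)‖ := by
      rw [← hmean, Real.circleAverage_eq_integral_add (-Real.pi), norm_smul]
      rw [Real.norm_of_nonneg (by positivity), ← mul_assoc, mul_inv_cancel₀ (by positivity),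
        one_mul]
      refine (intervalIntegral.norm_integral_le_integral_norm (by positivity)).trans_eq ?_
      rw [intervalIntegral.integral_comp_add_right (fun θ => ‖f (circleMap c ρ θ)‖)]
      congr 1 <;> ring
    have h2 : ENNReal.ofReal (2 * Real.pi * ‖f c‖) ≤
        ∫⁻ θ in Ioo (-Real.pi) Real.pi, ENNReal.ofReal ‖f (circleMap c ρ θ)‖ := by
      refine (ENNReal.ofReal_le_ofReal h1).trans_eq ?_
      rw [intervalIntegral.integral_of_le (by linarith), integral_Ioc_eq_integral_Ioo,
        ofReal_integral_eq_lintegral_ofReal]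
      · exact ((hcont.norm.integrableOn_Icc).mono_set Ioo_subset_Icc_self)
      · exact Filter.Eventually.of_forall fun _ => norm_nonneg _
    rw [mul_comm, ENNReal.ofReal_mul hρ.1.le]
    simp_rw [smul_eq_mul]
    rw [lintegral_const_mul' _ _ ENNReal.ofReal_ne_top]
    gcongr
    refine h2.trans_eq (lintegral_congr fun θ => ?_)
    have e : c + Complex.polarCoord.symm (ρ, θ) = circleMap c ρ θ := by
      simp [Complex.polarCoord_symm_apply, circleMap, Complex.exp_mul_I]
    have hmem : Complex.polarCoord.symm (ρ, θ) ∈ Metric.ball (0 : ℂ) r := by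
      rw [mem_ball_zero_iff, Complex.norm_polarCoord_symm, abs_of_pos hρ.1]
      exact hρ.2
    simp only [hF, indicator_of_mem hmem, e]
  calc ENNReal.ofReal (Real.pi * r ^ 2 * ‖f c‖)
      = ∫⁻ ρ in Ioo 0 r, ENNReal.ofReal (2 * Real.pi * ‖f c‖ * ρ) := by
        have hi : IntegrableOn (fun ρ => 2 * Real.pi * ‖f c‖ * ρ) (Ioo 0 r) :=
          ((continuous_const.mul continuous_id).integrableOn_Icc).mono_set Ioo_subset_Icc_self
        rw [← ofReal_integral_eq_lintegral_ofReal hi]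
        · rw [← integral_Ioc_eq_integral_Ioo, ← intervalIntegral.integral_of_le hr.le,
            intervalIntegral.integral_const_mul, integral_id]
          congr 1
          ring
        · refine (ae_restrict_mem measurableSet_Ioo).mono fun ρ hρ => ?_
          exact mul_nonneg (by positivity) hρ.1.le
    _ ≤ ∫⁻ ρ in Ioo 0 r, ∫⁻ θ in Ioo (-Real.pi) Real.pi,
        ENNReal.ofReal ρ • F (Complex.polarCoord.symm (ρ, θ)) :=
        setLIntegral_mono' measurableSet_Ioo hinner
    _ ≤ _ := lintegral_mono_set Ioo_subset_Ioi_self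

/-- A function with uniformly bounded modulars on horizontal lines is bounded on each half-plane
`{Im ≥ ε}`: average over discs of radius `ε / 2`, using `u ≤ l (1 + Φ (u / l) / Φ 1)`. -/
lemma exists_norm_le_of_lintegral_le {Φ : ℝ → ℝ} (hΦ : IsDoublingConvex Φ) {f : ℂ → ℂ}
    (hf : DifferentiableOn ℂ f {z : ℂ | 0 < z.im}) {l : ℝ} (hl : 0 < l)
    (hmod : ∀ y : ℝ, 0 < y →
      ∫⁻ x : ℝ, ENNReal.ofReal (Φ (‖f (x + y * Complex.I)‖ / l)) ≤ 1) {ε : ℝ} (hε : 0 < ε) :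
    ∃ M : ℝ, ∀ z : ℂ, ε ≤ z.im → ‖f z‖ ≤ M := by
  set U : Set ℂ := {z : ℂ | 0 < z.im} with hU
  have hUo : IsOpen U := isOpen_lt continuous_const Complex.continuous_im
  set g : ℂ → ℂ := U.indicator f with hg
  have hgm : Measurable g := by
    have := hf.continuousOn.measurable_piecewise (g := fun _ => (0 : ℂ)) continuousOn_const
      hUo.measurableSet
    convert this using 1
    exact (Set.piecewise_eq_indicator).symm
  have hgf : ∀ z ∈ U, g z = f z := fun z hz => indicator_of_mem hz _
  set r : ℝ := ε / 2 with hr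
  have hr0 : 0 < r := by positivity
  have h1 := hΦ.pos one_pos
  have hpi := Real.pi_pos
  set N : ℝ := l * (Real.pi * r ^ 2) + l / Φ 1 * (2 * r) with hN
  refine ⟨N / (Real.pi * r ^ 2), fun z hz => ?_⟩
  have hball : ∀ w ∈ Metric.ball z r, w.im ∈ Ioo (z.im - r) (z.im + r) ∧ w ∈ U := by
    intro w hw
    have h2 := (Complex.abs_im_le_norm (w - z)).trans_lt (mem_ball_iff_norm.1 hw)
    rw [Complex.sub_im, abs_lt] at h2
    refine ⟨⟨by linarith, by linarith⟩, ?_⟩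
    simp only [hU, mem_ofPred_eq]
    linarith
  have harea := ofReal_norm_mul_le_lintegral_ball hr0
    ((hf.mono fun w hw => (hball w hw).2).congr fun w hw => hgf w (hball w hw).2) hgm
  have hpt : ∀ u : ℝ, 0 ≤ u → u ≤ l + l / Φ 1 * Φ (u / l) := by
    intro u hu
    have h0 : 0 ≤ l / Φ 1 * Φ (u / l) := mul_nonneg (by positivity) (hΦ.nonneg (by positivity))
    rcases le_total u l with h | h
    · linarith
    · have := hΦ.map_mul_le_map_mul zero_le_one ((one_le_div hl).2 h)
      have h3 : u ≤ l / Φ 1 * Φ (u / l) := by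
        rw [mul_one, mul_div_assoc', div_le_iff₀ hl] at this
        rw [div_mul_eq_mul_div, le_div_iff₀ h1]
        linarith
      linarith
  have hΦm : Measurable fun w : ℂ => ENNReal.ofReal (Φ (‖g w‖ / l)) :=
    hΦ.isGrowthFunction.measurable_comp (hgm.norm.div_const l) fun w => by positivity
  have hstrip : ∫⁻ w in Metric.ball z r, ENNReal.ofReal (Φ (‖g w‖ / l)) ≤
      ENNReal.ofReal (2 * r) := by
    calc ∫⁻ w in Metric.ball z r, ENNReal.ofReal (Φ (‖g w‖ / l))
        ≤ ∫⁻ w, (Complex.im ⁻¹' Ioo (z.im - r) (z.im + r)).indicator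
            (fun w => ENNReal.ofReal (Φ (‖g w‖ / l))) w := by
          rw [lintegral_indicator (Complex.measurable_im measurableSet_Ioo)]
          exact lintegral_mono_set fun w hw => (hball w hw).1
      _ = ∫⁻ p : ℝ × ℝ, (Prod.snd ⁻¹' Ioo (z.im - r) (z.im + r)).indicator
            (fun p : ℝ × ℝ => ENNReal.ofReal (Φ (‖g (p.1 + p.2 * Complex.I)‖ / l))) p := by
          rw [← Complex.volume_preserving_equiv_real_prod.symm.lintegral_comp_emb
            Complex.measurableEquivRealProd.symm.measurableEmbedding]
          refine lintegral_congr fun p => ?_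
          simp only [Complex.measurableEquivRealProd_symm_apply, indicator, mem_preimage,
            Complex.mk_eq_add_mul_I]
          simp
      _ = ∫⁻ y, ∫⁻ x, (Prod.snd ⁻¹' Ioo (z.im - r) (z.im + r)).indicator
            (fun p : ℝ × ℝ => ENNReal.ofReal (Φ (‖g (p.1 + p.2 * Complex.I)‖ / l))) (x, y) := by
          rw [Measure.volume_eq_prod, lintegral_prod_symm]
          refine (Measurable.indicator ?_ (measurable_snd measurableSet_Ioo)).aemeasurable
          exact hΦm.comp (by fun_prop : Measurable fun p : ℝ × ℝ => (p.1 + p.2 * Complex.I : ℂ))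
      _ ≤ ∫⁻ y, (Ioo (z.im - r) (z.im + r)).indicator (fun _ => (1 : ENNReal)) y := by
          refine lintegral_mono fun y => ?_
          by_cases hy : y ∈ Ioo (z.im - r) (z.im + r)
          · have hy0 : 0 < y := by linarith [hy.1]
            rw [indicator_of_mem hy]
            refine le_trans (lintegral_mono fun x => ?_) (hmod y hy0)
            rw [indicator_of_mem (by exact hy), hgf]
            simpa [hU] using hy0
          · rw [indicator_of_notMem hy]
            refine (lintegral_congr fun x => indicator_of_notMem (by exact hy) _).trans_le ?_
            simp
      _ = ENNReal.ofReal (2 * r) := by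
          rw [lintegral_indicator measurableSet_Ioo, setLIntegral_one, Real.volume_Ioo]
          congr 1
          ring
  have htot : ∫⁻ w in Metric.ball z r, ENNReal.ofReal ‖g w‖ ≤ ENNReal.ofReal N := by
    calc ∫⁻ w in Metric.ball z r, ENNReal.ofReal ‖g w‖
        ≤ ∫⁻ w in Metric.ball z r,
          (ENNReal.ofReal l + ENNReal.ofReal (l / Φ 1) * ENNReal.ofReal (Φ (‖g w‖ / l))) := by
          refine lintegral_mono fun w => ?_
          refine (ENNReal.ofReal_le_ofReal (hpt _ (norm_nonneg _))).trans ?_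
          refine ENNReal.ofReal_add_le.trans ?_
          rw [ENNReal.ofReal_mul (by positivity)]
      _ = ENNReal.ofReal l * volume (Metric.ball z r) + ENNReal.ofReal (l / Φ 1) *
          ∫⁻ w in Metric.ball z r, ENNReal.ofReal (Φ (‖g w‖ / l)) := by
          rw [lintegral_add_left measurable_const, lintegral_const_mul _ hΦm, setLIntegral_const]
      _ ≤ ENNReal.ofReal l * ENNReal.ofReal (Real.pi * r ^ 2) +
          ENNReal.ofReal (l / Φ 1) * ENNReal.ofReal (2 * r) := by
          gcongr
          rw [Complex.volume_ball, ENNReal.ofReal_mul hpi.le, ENNReal.ofReal_pow hr0.le, mul_comm,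
            ← NNReal.coe_real_pi, ENNReal.ofReal_coe_nnreal]
      _ = ENNReal.ofReal N := by
          rw [← ENNReal.ofReal_mul hl.le, ← ENNReal.ofReal_mul (by positivity),
            ← ENNReal.ofReal_add (by positivity) (by positivity)]
  have hfin := (ENNReal.ofReal_le_ofReal_iff (by positivity)).1 (harea.trans htot)
  rw [hgf z (by simp only [hU, mem_ofPred_eq]; linarith)] at hfin
  rw [le_div_iff₀ (by positivity)]
  linarith

/-! ### Covering lemma and level sets of Poisson integrals -/

lemma volume_real_closedBall {x r : ℝ} (hr : 0 ≤ r) :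
    volume.real (Metric.closedBall x r) = 2 * r := by
  rw [Measure.real, Real.volume_closedBall, ENNReal.toReal_ofReal (by positivity)]

/-- Covering lemma for Carleson measures. Suppose that each point of `E` lies in the Carleson box
over an interval with the same centre on which `g` has average greater than `Λ`. Vitali's covering
lemma provides disjoint intervals of this kind whose fivefold dilations carry boxes covering `E`,
and since `W s / s` is nondecreasing the bounds for these boxes add up. Only the part of `g` above
the level `Λ / 2` is needed to bound the total length. -/
lemma measure_le_of_forall_exists_interval {μ : Measure UpperHalfPlane} {W : ℝ → ℝ}
    (hW : ∀ s t, 0 < s → s ≤ t → W s * t ≤ W t * s) {C : ℝ} (hC : 0 ≤ C)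
    (hμ : ∀ x r : ℝ, 0 < r →
      μ (carlesonSquare (Metric.closedBall x r)) ≤ ENNReal.ofReal (C * W (2 * r)))
    {g : ℝ → ENNReal} (hg : Measurable g) {Λ : ℝ} (hΛ : 0 < Λ) {E : Set UpperHalfPlane}
    (hE : ∀ z ∈ E, ∃ r : ℝ, z.im ≤ r ∧
      ENNReal.ofReal (Λ * (2 * r)) < ∫⁻ t in Metric.closedBall z.re r, g t)
    {T : ℝ} (hT0 : 0 < T) (hWT : 0 ≤ W T)
    (hT : ENNReal.ofReal (10 / Λ) * ∫⁻ t in {t | ENNReal.ofReal (Λ / 2) < g t}, g t ≤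
      ENNReal.ofReal T) :
    μ E ≤ ENNReal.ofReal (C * (W T / T)) *
      (ENNReal.ofReal (10 / Λ) * ∫⁻ t in {t | ENNReal.ofReal (Λ / 2) < g t}, g t) := by
  have hms : MeasurableSet {t | ENNReal.ofReal (Λ / 2) < g t} := measurableSet_lt measurable_const hg
  set h : ℝ → ENNReal := {t | ENNReal.ofReal (Λ / 2) < g t}.indicator g with hh
  have hhm : Measurable h := hg.indicator hms
  rw [← lintegral_indicator hms] at hT ⊢
  choose! r hr1 hr2 using hE
  have hr0 : ∀ z ∈ E, 0 < r z := fun z hz => z.im_pos.trans_le (hr1 z hz)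
  have hlen : ∀ z ∈ E, ENNReal.ofReal (10 * r z) ≤
      ENNReal.ofReal (10 / Λ) * ∫⁻ t in Metric.closedBall z.re (r z), h t := by
    intro z hz
    have hrz := hr0 z hz
    have h1 : ∫⁻ t in Metric.closedBall z.re (r z), g t ≤ ENNReal.ofReal (Λ * r z) +
        ∫⁻ t in Metric.closedBall z.re (r z), h t := by
      calc ∫⁻ t in Metric.closedBall z.re (r z), g t
          ≤ ∫⁻ t in Metric.closedBall z.re (r z), (ENNReal.ofReal (Λ / 2) + h t) := by
            refine lintegral_mono fun t => ?_
            by_cases ht : ENNReal.ofReal (Λ / 2) < g t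
            · simp only [hh, indicator, mem_ofPred_eq, ht, if_true]
              exact le_add_self
            · exact (not_lt.1 ht).trans le_self_add
        _ = _ := by
            rw [lintegral_add_left measurable_const, setLIntegral_const, Real.volume_closedBall,
              ← ENNReal.ofReal_mul (by positivity)]
            congr 2
            ring
    have h2 := (hr2 z hz).le.trans h1
    rw [show Λ * (2 * r z) = Λ * r z + Λ * r z by ring,
      ENNReal.ofReal_add (by positivity) (by positivity),
      ENNReal.add_le_add_iff_left ENNReal.ofReal_ne_top] at h2
    calc ENNReal.ofReal (10 * r z) = ENNReal.ofReal (10 / Λ) * ENNReal.ofReal (Λ * r z) := by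
          rw [← ENNReal.ofReal_mul (by positivity)]
          congr 1
          field_simp
      _ ≤ _ := by gcongr
  have hrT : ∀ z ∈ E, 10 * r z ≤ T := fun z hz => by
    refine (ENNReal.ofReal_le_ofReal_iff hT0.le).1 ((hlen z hz).trans (le_trans ?_ hT))
    gcongr
    exact Measure.restrict_le_self
  obtain ⟨u, huE, hdisj, hcov⟩ :=
    Vitali.exists_disjoint_subfamily_covering_enlargement_closedBall E (fun z => z.re) r (T / 10)
      (fun z hz => by linarith [hrT z hz]) 5 (by norm_num)
  have hucount : u.Countable := by
    refine hdisj.countable_of_nonempty_interior fun z hz => ?_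
    rw [interior_closedBall _ (hr0 z (huE hz)).ne']
    exact Metric.nonempty_ball.2 (hr0 z (huE hz))
  have hsub : E ⊆ ⋃ b ∈ u, carlesonSquare (Metric.closedBall b.re (5 * r b)) := by
    intro z hz
    obtain ⟨b, hb, hzb⟩ := hcov z hz
    have hrb := hr0 b (huE hb)
    refine mem_biUnion hb ⟨hzb (Metric.mem_closedBall_self (hr0 z hz).le), ?_⟩
    rw [volume_real_closedBall (by positivity)]
    have h1 := measure_mono (μ := volume) hzb
    rw [Real.volume_closedBall, Real.volume_closedBall,
      ENNReal.ofReal_le_ofReal_iff (by positivity)] at h1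
    linarith [hr1 z hz]
  calc μ E ≤ ∑' b : u, μ (carlesonSquare (Metric.closedBall b.1.re (5 * r b))) :=
        (measure_mono hsub).trans (measure_biUnion_le μ hucount _)
    _ ≤ ∑' b : u, ENNReal.ofReal (C * (W T / T)) * (ENNReal.ofReal (10 / Λ) *
          ∫⁻ t in Metric.closedBall b.1.re (r b), h t) := by
        refine ENNReal.tsum_le_tsum fun b => ?_
        have hrb := hr0 b (huE b.2)
        refine (hμ _ _ (by positivity)).trans ?_
        refine le_trans ?_ (mul_le_mul_right (hlen b (huE b.2)) _)
        rw [← ENNReal.ofReal_mul (by positivity)]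
        refine ENNReal.ofReal_le_ofReal ?_
        have := hW (10 * r b) T (by positivity) (hrT b (huE b.2))
        rw [show 2 * (5 * r (b : UpperHalfPlane)) = 10 * r b by ring, mul_assoc]
        refine mul_le_mul_of_nonneg_left ?_ hC
        rw [div_mul_eq_mul_div, le_div_iff₀ hT0]
        exact this
    _ = ENNReal.ofReal (C * (W T / T)) * (ENNReal.ofReal (10 / Λ) *
          ∫⁻ t in ⋃ b : u, Metric.closedBall b.1.re (r b), h t) := by
        have := hucount.to_subtype
        rw [ENNReal.tsum_mul_left, ENNReal.tsum_mul_left, lintegral_iUnion]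
        · exact fun b => measurableSet_closedBall
        · exact fun b c hbc => hdisj b.2 c.2 fun h => hbc (Subtype.ext h)
    _ ≤ _ := by
        gcongr
        exact Measure.restrict_le_self

/-- Where the Poisson integral of `g` exceeds `16 Λ`, some interval of half-length at least `y`
about the same centre has average of `g` greater than `Λ`: the Poisson kernel is at most
`∑ₖ 4 · 4⁻ᵏ / (π y)` times the indicator of the interval of half-length `2ᵏ y`. -/
lemma exists_interval_of_lt_poisson {g : ℝ → ℝ} (hg : Measurable g) (hg0 : ∀ t, 0 ≤ g t)
    {Λ x y : ℝ} (hΛ : 0 < Λ) (hy : 0 < y)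
    (h : ENNReal.ofReal (16 * Λ) <
      ∫⁻ t : ℝ, ENNReal.ofReal (y / (Real.pi * ((t - x) ^ 2 + y ^ 2)) * g t)) :
    ∃ r : ℝ, y ≤ r ∧
      ENNReal.ofReal (Λ * (2 * r)) < ∫⁻ t in Metric.closedBall x r, ENNReal.ofReal (g t) := by
  by_contra! hcon
  refine h.not_ge ?_
  have hpi : 1 ≤ Real.pi := by linarith [Real.pi_gt_three]
  have hpi0 := Real.pi_pos
  have hgm : Measurable fun t => ENNReal.ofReal (g t) := hg.ennreal_ofReal
  have hker : ∀ t, ENNReal.ofReal (y / (Real.pi * ((t - x) ^ 2 + y ^ 2)) * g t) ≤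
      ∑' k : ℕ, ENNReal.ofReal (4 * (1 / 4) ^ k / y) *
        (Metric.closedBall x (2 ^ k * y)).indicator (fun t => ENNReal.ofReal (g t)) t := by
    intro t
    -- the first `k` for which `t` lies in the interval of half-length `2ᵏ y`
    have hex : ∃ k : ℕ, |t - x| ≤ 2 ^ k * y := by
      obtain ⟨k, hk⟩ := pow_unbounded_of_one_lt (|t - x| / y) one_lt_two
      exact ⟨k, ((div_lt_iff₀ hy).1 hk).le⟩
    classical
    set k := Nat.find hex with hk
    have hkt : |t - x| ≤ 2 ^ k * y := Nat.find_spec hex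
    have hlow : 4 ^ k * y ^ 2 ≤ 4 * ((t - x) ^ 2 + y ^ 2) := by
      rcases Nat.eq_zero_or_pos k with h0 | h0
      · rw [h0]
        nlinarith [sq_nonneg (t - x), sq_nonneg y]
      · obtain ⟨j, hj⟩ := Nat.exists_eq_succ_of_ne_zero h0.ne'
        have hmin := Nat.find_min hex (show j < Nat.find hex by lia)
        rw [not_le] at hmin
        have h2 : (2 ^ j * y) ^ 2 ≤ |t - x| ^ 2 := by gcongr
        rw [sq_abs, mul_pow, ← pow_mul, mul_comm j, pow_mul] at h2
        norm_num at h2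
        rw [hj, Nat.succ_eq_add_one, pow_succ]
        nlinarith [sq_nonneg y]
    refine le_trans ?_ (ENNReal.le_tsum k)
    rw [indicator_of_mem (by simpa [Real.dist_eq] using hkt),
      ← ENNReal.ofReal_mul (by positivity)]
    refine ENNReal.ofReal_le_ofReal (mul_le_mul_of_nonneg_right ?_ (hg0 t))
    rw [one_div, inv_pow, ← div_eq_mul_inv, div_div, div_le_div_iff₀ (by positivity) (by positivity)]
    have h3 : (t - x) ^ 2 + y ^ 2 ≤ Real.pi * ((t - x) ^ 2 + y ^ 2) :=
      le_mul_of_one_le_left (by positivity) hpi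
    nlinarith
  have hgeom : ∑' k : ℕ, ENNReal.ofReal (8 * Λ * (1 / 2) ^ k) = ENNReal.ofReal (16 * Λ) := by
    rw [← ENNReal.ofReal_tsum_of_nonneg (fun k => by positivity)
      (summable_geometric_two.mul_left _), tsum_mul_left, tsum_geometric_two]
    congr 1
    ring
  calc ∫⁻ t : ℝ, ENNReal.ofReal (y / (Real.pi * ((t - x) ^ 2 + y ^ 2)) * g t)
      ≤ ∫⁻ t, ∑' k : ℕ, ENNReal.ofReal (4 * (1 / 4) ^ k / y) *
        (Metric.closedBall x (2 ^ k * y)).indicator (fun t => ENNReal.ofReal (g t)) t :=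
        lintegral_mono hker
    _ = ∑' k : ℕ, ENNReal.ofReal (4 * (1 / 4) ^ k / y) *
        ∫⁻ t in Metric.closedBall x (2 ^ k * y), ENNReal.ofReal (g t) := by
        rw [lintegral_tsum fun k =>
          ((hgm.indicator measurableSet_closedBall).const_mul _).aemeasurable]
        refine tsum_congr fun k => ?_
        rw [lintegral_const_mul _ (hgm.indicator measurableSet_closedBall),
          lintegral_indicator measurableSet_closedBall]
    _ ≤ ∑' k : ℕ, ENNReal.ofReal (8 * Λ * (1 / 2) ^ k) := by
        refine ENNReal.tsum_le_tsum fun k => ?_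
        refine (mul_le_mul_right (hcon (2 ^ k * y)
          (le_mul_of_one_le_left hy.le (one_le_pow₀ one_le_two))) _).trans ?_
        rw [← ENNReal.ofReal_mul (by positivity)]
        refine ENNReal.ofReal_le_ofReal (le_of_eq ?_)
        have e : (1 / 4 : ℝ) ^ k * 2 ^ k = (1 / 2) ^ k := by rw [← mul_pow]; norm_num
        rw [← e]
        field_simp
        ring
    _ = ENNReal.ofReal (16 * Λ) := hgeom

/-- Dyadic form of `u ∫₀ᵘ Φ(s) / s² ds ≤ D Φ(u)`. -/
lemma IsDini.tsum_zpow_le {Φ : ℝ → ℝ} (hΦ : IsDoublingConvex Φ) {D : ℝ} (hD0 : 0 ≤ D)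
    (hD : IsDini Φ D) {u : ℝ} (hu : 0 ≤ u) :
    ∑' k : ℤ, ENNReal.ofReal (Φ (2 ^ k) / 2 ^ k) * (if (2 : ℝ) ^ k < u then ENNReal.ofReal u else 0)
      ≤ ENNReal.ofReal (D * Φ u) := by
  rcases hu.eq_or_lt with rfl | hu
  · simp
  obtain ⟨n, hn1, hn2⟩ := exists_mem_Ioc_zpow hu one_lt_two
  have hinj : Function.Injective fun i : ℕ => n - (i : ℤ) := fun i j hij => by
    simp only at hij; lia
  have hpos : (0 : ℝ) < 2 ^ n := by positivity
  rw [← hinj.tsum_eq]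
  · calc ∑' i : ℕ, ENNReal.ofReal (Φ (2 ^ (n - (i : ℤ))) / 2 ^ (n - (i : ℤ))) *
          (if (2 : ℝ) ^ (n - (i : ℤ)) < u then ENNReal.ofReal u else 0)
        ≤ ∑' i : ℕ, ENNReal.ofReal (u / 2 ^ n) *
            ENNReal.ofReal (2 ^ i * Φ ((1 / 2) ^ i * 2 ^ n)) := by
          refine ENNReal.tsum_le_tsum fun i => ?_
          have hif : (if (2 : ℝ) ^ (n - (i : ℤ)) < u then ENNReal.ofReal u else 0) ≤
              ENNReal.ofReal u := by split_ifs <;> simp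
          refine (mul_le_mul_right hif _).trans ?_
          rw [← ENNReal.ofReal_mul (div_nonneg (hΦ.nonneg (by positivity)) (by positivity)),
            ← ENNReal.ofReal_mul (by positivity)]
          refine ENNReal.ofReal_le_ofReal (le_of_eq ?_)
          rw [zpow_sub₀ two_ne_zero, zpow_natCast, one_div, inv_pow, inv_mul_eq_div]
          field_simp
      _ ≤ ENNReal.ofReal (u / 2 ^ n) * ENNReal.ofReal (D * Φ (2 ^ n)) := by
          rw [ENNReal.tsum_mul_left]
          gcongr
          exact hD _ hpos.le
      _ ≤ _ := by
          rw [← ENNReal.ofReal_mul (by positivity)]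
          refine ENNReal.ofReal_le_ofReal ?_
          have := hΦ.map_mul_le_map_mul hpos.le hn1.le
          rw [div_mul_eq_mul_div, div_le_iff₀ hpos]
          calc u * (D * Φ (2 ^ n)) = D * (Φ (2 ^ n) * u) := by ring
            _ ≤ D * (Φ u * 2 ^ n) := by gcongr
            _ = _ := by ring
  · intro k hk
    rw [Function.mem_support] at hk
    have hku : (2 : ℝ) ^ k < u := by
      by_contra hcon
      simp [hcon] at hk
    have hkn : k < n + 1 := (zpow_lt_zpow_iff_right₀ one_lt_two).1 (hku.trans_le hn2)
    exact ⟨(n - k).toNat, by simp only; lia⟩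

/-! ### The modular estimate -/

/-- For `W s = 1 / Φ₂ (Φ₁⁻¹ (1 / s))` the quotient `W s / s` is nondecreasing. -/
lemma inv_comp_growthInv_mul_le {Φ₁ Φ₂ : ℝ → ℝ} (h₁ : IsDoublingConvex Φ₁)
    (hmono : MonotoneOn (fun t => Φ₂ t / Φ₁ t) (Ioi 0)) (h₂ : IsDoublingConvex Φ₂)
    {s t : ℝ} (hs : 0 < s) (hst : s ≤ t) :
    (Φ₂ (growthInv Φ₁ (1 / s)))⁻¹ * t ≤ (Φ₂ (growthInv Φ₁ (1 / t)))⁻¹ * s := by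
  have ht : 0 < t := hs.trans_le hst
  have hs' : 0 < 1 / s := by positivity
  have ht' : 0 < 1 / t := by positivity
  have h := hmono (h₁.growthInv_pos ht') (h₁.growthInv_pos hs')
    (h₁.growthInv_mono ht'.le (one_div_le_one_div_of_le hs hst))
  simp only at h
  rw [h₁.map_growthInv ht'.le, h₁.map_growthInv hs'.le, div_div_eq_mul_div, div_div_eq_mul_div,
    div_one, div_one] at h
  have p1 := h₂.pos (h₁.growthInv_pos ht')
  have p2 := h₂.pos (h₁.growthInv_pos hs')
  rw [inv_mul_eq_div, inv_mul_eq_div, div_le_div_iff₀ p2 p1]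
  linarith

/-- The modular estimate behind the embedding, for functions dominated by the Poisson integral of
a function `g` of modular at most `1`. The level set `{F > 32 m}` is bounded by the covering lemma
in terms of `∫_{g > m} g`, and the sum over dyadic `m` is controlled by the Dini condition. -/
theorem exists_lintegral_le_of_poisson {Φ₁ Φ₂ : ℝ → ℝ} (h₁ : IsDoublingConvex Φ₁)
    (h₂ : IsDoublingConvex Φ₂) (hmono : MonotoneOn (fun t => Φ₂ t / Φ₁ t) (Ioi 0))
    {D : ℝ} (hD0 : 0 ≤ D) (hD : IsDini Φ₁ D) {μ : Measure UpperHalfPlane}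
    (hμ : IsCarlesonMeasure (Φ₂ ∘ growthInv Φ₁) μ) :
    ∃ B : ℝ, 1 ≤ B ∧ ∀ (F : UpperHalfPlane → ℝ) (g : ℝ → ℝ), Measurable F → (∀ z, 0 ≤ F z) →
      Measurable g → (∀ t, 0 ≤ g t) →
      (∀ z : UpperHalfPlane, ENNReal.ofReal (F z) ≤ ∫⁻ t : ℝ,
        ENNReal.ofReal (z.im / (Real.pi * ((t - z.re) ^ 2 + z.im ^ 2)) * g t)) →
      ∫⁻ t, ENNReal.ofReal (Φ₁ (g t)) ≤ 1 →
      ∫⁻ z, ENNReal.ofReal (Φ₂ (F z)) ∂μ ≤ ENNReal.ofReal B := by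
  obtain ⟨C, hC0, hC⟩ := hμ
  -- `320 = 64 * 5`: the points `64 m` and `m / 5` have to be compared below
  obtain ⟨D₂, hD₂, hdbl⟩ := h₂.exists_map_mul_le 320 (by norm_num)
  set W : ℝ → ℝ := fun s => (Φ₂ (growthInv Φ₁ (1 / s)))⁻¹ with hWdef
  have hWnn : ∀ s, 0 < s → 0 ≤ W s := fun s hs =>
    inv_nonneg.2 (h₂.nonneg (h₁.growthInv_nonneg (by positivity)))
  have hbox : ∀ x r : ℝ, 0 < r →
      μ (carlesonSquare (Metric.closedBall x r)) ≤ ENNReal.ofReal (C * W (2 * r)) := by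
    intro x r hr
    have hv := volume_real_closedBall (x := x) hr.le
    have := hC (Metric.closedBall x r) (by rw [Real.closedBall_eq_Icc]; exact ordConnected_Icc)
      Metric.isBounded_closedBall (by rw [hv]; positivity)
    rwa [hv] at this
  refine ⟨max 1 (C * D₂ * D), le_max_left _ _, fun F g hF hF0 hg hg0 hP hmod => ?_⟩
  have hgm : Measurable fun t => ENNReal.ofReal (g t) := hg.ennreal_ofReal
  set S : ℤ → ENNReal := fun k => ∫⁻ t in {t | ENNReal.ofReal (2 ^ k) < ENNReal.ofReal (g t)},
    ENNReal.ofReal (g t) with hS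
  have hset : ∀ k : ℤ, {t | ENNReal.ofReal (2 ^ k) < ENNReal.ofReal (g t)} =
      {t | (2 : ℝ) ^ k < g t} := fun k => by
    ext t
    simp only [mem_ofPred_eq]
    exact ENNReal.ofReal_lt_ofReal_iff_of_nonneg (by positivity)
  have hms : ∀ k : ℤ, MeasurableSet {t | (2 : ℝ) ^ k < g t} := fun k =>
    measurableSet_lt measurable_const hg
  have hSle : ∀ k : ℤ, S k ≤ ENNReal.ofReal (2 ^ k / Φ₁ (2 ^ k)) := by
    intro k
    have hm : (0 : ℝ) < 2 ^ k := by positivity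
    have hp := h₁.pos hm
    have hΦm := h₁.isGrowthFunction.measurable_comp hg hg0
    calc S k ≤ ∫⁻ t in {t | ENNReal.ofReal (2 ^ k) < ENNReal.ofReal (g t)},
          ENNReal.ofReal (2 ^ k / Φ₁ (2 ^ k)) * ENNReal.ofReal (Φ₁ (g t)) := by
          refine setLIntegral_mono' (by rw [hset]; exact hms k) fun t ht => ?_
          rw [hset] at ht
          rw [← ENNReal.ofReal_mul (by positivity)]
          refine ENNReal.ofReal_le_ofReal ?_
          have := h₁.map_mul_le_map_mul hm.le (le_of_lt ht)
          rw [div_mul_eq_mul_div, le_div_iff₀ hp]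
          linarith
      _ ≤ ∫⁻ t, ENNReal.ofReal (2 ^ k / Φ₁ (2 ^ k)) * ENNReal.ofReal (Φ₁ (g t)) :=
          setLIntegral_le_lintegral _ _
      _ ≤ _ := by
          rw [lintegral_const_mul _ hΦm]
          exact mul_le_of_le_one_right' hmod
  -- covering lemma with `Λ = 2 m`; by `hSle` the enlarged intervals have total length at most
  -- `T = 5 / Φ₁ m`
  have hlevel : ∀ k : ℤ, ENNReal.ofReal (Φ₂ (64 * 2 ^ k)) * μ {z | 32 * 2 ^ k < F z} ≤
      ENNReal.ofReal (C * D₂) * (ENNReal.ofReal (Φ₁ (2 ^ k) / 2 ^ k) * S k) := by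
    intro k
    set m : ℝ := 2 ^ k with hm_def
    have hm : 0 < m := by positivity
    have hp := h₁.pos hm
    have hp2 := h₂.pos (show 0 < m / 5 by positivity)
    have hT0 : 0 < 5 / Φ₁ m := by positivity
    have hcov := measure_le_of_forall_exists_interval (μ := μ) (W := W)
      (fun s t hs hst => inv_comp_growthInv_mul_le h₁ hmono h₂ hs hst) hC0.le hbox hgm
      (Λ := 2 * m) (by positivity) (E := {z | 32 * m < F z}) (fun z hz => by
        refine exists_interval_of_lt_poisson hg hg0 (by positivity) z.im_pos ?_
        refine lt_of_lt_of_le ?_ (hP z)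
        rw [ENNReal.ofReal_lt_ofReal_iff_of_nonneg (by positivity)]
        rw [mem_ofPred_eq] at hz
        linarith)
      hT0 (hWnn _ hT0) (by
        rw [show 2 * m / 2 = m by ring]
        refine (mul_le_mul_right (hSle k) _).trans ?_
        rw [← ENNReal.ofReal_mul (by positivity)]
        refine ENNReal.ofReal_le_ofReal (le_of_eq ?_)
        rw [← hm_def]
        field_simp
        norm_num)
    rw [show 2 * m / 2 = m by ring] at hcov
    change μ {z | 32 * m < F z} ≤ _ * (_ * S k) at hcov
    have hWT : W (5 / Φ₁ m) ≤ (Φ₂ (m / 5))⁻¹ := by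
      refine inv_anti₀ hp2 (h₂.mono (by positivity) ?_)
      rw [one_div_div, h₁.le_growthInv_iff (by positivity) (by positivity)]
      have := h₁.map_mul_le (θ := 1 / 5) (t := m) (by norm_num) (by norm_num) hm.le
      rw [show m / 5 = 1 / 5 * m by ring]
      linarith
    have h64 : Φ₂ (64 * m) ≤ D₂ * Φ₂ (m / 5) := by
      have := hdbl (m / 5) (by positivity)
      rwa [show 320 * (m / 5) = 64 * m by ring] at this
    refine (mul_le_mul_right hcov _).trans ?_
    rw [← mul_assoc, ← mul_assoc, ← mul_assoc]
    refine mul_le_mul_left ?_ _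
    have hn1 := h₂.nonneg (show 0 ≤ 64 * m by positivity)
    have hn2 := hWnn _ hT0
    rw [← ENNReal.ofReal_mul hn1, ← ENNReal.ofReal_mul (by positivity),
      ← ENNReal.ofReal_mul (by positivity)]
    refine ENNReal.ofReal_le_ofReal ?_
    calc Φ₂ (64 * m) * (C * (W (5 / Φ₁ m) / (5 / Φ₁ m))) * (10 / (2 * m))
        ≤ D₂ * Φ₂ (m / 5) * (C * ((Φ₂ (m / 5))⁻¹ / (5 / Φ₁ m))) * (10 / (2 * m)) := by gcongr
      _ = C * D₂ * (Φ₁ m / m) := by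
        field_simp
        norm_num
  have hpt : ∀ z, ENNReal.ofReal (Φ₂ (F z)) ≤ ∑' k : ℤ,
      {z | 32 * 2 ^ k < F z}.indicator (fun _ => ENNReal.ofReal (Φ₂ (64 * 2 ^ k))) z := by
    intro z
    rcases (hF0 z).eq_or_lt with h0 | h0
    · simp [← h0, h₂.map_zero]
    obtain ⟨k, hk1, hk2⟩ := exists_mem_Ioc_zpow (show 0 < F z / 32 by positivity) one_lt_two
    refine le_trans ?_ (ENNReal.le_tsum k)
    rw [indicator_of_mem (by simp only [mem_ofPred_eq]; linarith)]
    refine ENNReal.ofReal_le_ofReal (h₂.mono h0.le ?_)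
    rw [zpow_add₀ two_ne_zero, zpow_one] at hk2
    linarith
  have hEm : ∀ k : ℤ, MeasurableSet {z | 32 * 2 ^ k < F z} := fun k =>
    measurableSet_lt measurable_const hF
  calc ∫⁻ z, ENNReal.ofReal (Φ₂ (F z)) ∂μ
      ≤ ∫⁻ z, ∑' k : ℤ, {z | 32 * 2 ^ k < F z}.indicator
          (fun _ => ENNReal.ofReal (Φ₂ (64 * 2 ^ k))) z ∂μ := lintegral_mono hpt
    _ = ∑' k : ℤ, ENNReal.ofReal (Φ₂ (64 * 2 ^ k)) * μ {z | 32 * 2 ^ k < F z} := by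
        rw [lintegral_tsum fun k => (measurable_const.indicator (hEm k)).aemeasurable]
        exact tsum_congr fun k => lintegral_indicator_const (hEm k) _
    _ ≤ ∑' k : ℤ, ENNReal.ofReal (C * D₂) * (ENNReal.ofReal (Φ₁ (2 ^ k) / 2 ^ k) * S k) :=
        ENNReal.tsum_le_tsum hlevel
    _ = ENNReal.ofReal (C * D₂) * ∫⁻ t, ∑' k : ℤ, ENNReal.ofReal (Φ₁ (2 ^ k) / 2 ^ k) *
          (if (2 : ℝ) ^ k < g t then ENNReal.ofReal (g t) else 0) := by
        have him : ∀ k : ℤ, Measurable fun t =>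
            (if (2 : ℝ) ^ k < g t then ENNReal.ofReal (g t) else 0) := fun k =>
          Measurable.ite (hms k) hgm measurable_const
        rw [ENNReal.tsum_mul_left, lintegral_tsum fun k => ((him k).const_mul _).aemeasurable]
        congr 1
        refine tsum_congr fun k => ?_
        rw [lintegral_const_mul _ (him k)]
        congr 1
        simp only [hS]
        rw [hset, ← lintegral_indicator (hms k)]
        rfl
    _ ≤ ENNReal.ofReal (C * D₂) * ∫⁻ t, ENNReal.ofReal D * ENNReal.ofReal (Φ₁ (g t)) := by
        gcongr with t
        rw [← ENNReal.ofReal_mul hD0]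
        exact hD.tsum_zpow_le h₁ hD0 (hg0 t)
    _ ≤ ENNReal.ofReal (C * D₂) * (ENNReal.ofReal D * 1) := by
        rw [lintegral_const_mul _ (h₁.isGrowthFunction.measurable_comp hg hg0)]
        gcongr
    _ ≤ ENNReal.ofReal (max 1 (C * D₂ * D)) := by
        rw [mul_one, ← ENNReal.ofReal_mul (by positivity)]
        exact ENNReal.ofReal_le_ofReal (le_max_right _ _)

/-! ### Embedding of the Hardy–Orlicz space -/

/-- If the Luxembourg norm is less than `l`, the modular at scale `l` is at most `1`. -/
lemma lintegral_le_one_of_luxNorm_lt {Φ : ℝ → ℝ} (h : IsDoublingConvex Φ) {α : Type*}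
    [MeasurableSpace α] {ν : Measure α} {g : α → ℂ} {l : ℝ}
    (hg : luxNorm Φ ν g < ENNReal.ofReal l) :
    ∫⁻ x, ENNReal.ofReal (Φ (‖g x‖ / l)) ∂ν ≤ 1 := by
  simp only [luxNorm, iInf_lt_iff] at hg
  obtain ⟨s, hs, hs1, hsl⟩ := hg
  have hsl' : s ≤ l := ((ENNReal.ofReal_lt_ofReal_iff_of_nonneg hs.le).1 hsl).le
  have hl := hs.trans_le hsl'
  refine le_trans (lintegral_mono fun x => ENNReal.ofReal_le_ofReal (h.mono (by positivity) ?_)) hs1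
  gcongr

lemma luxNorm_le_of_lintegral_le_one {Φ : ℝ → ℝ} {α : Type*} [MeasurableSpace α] {ν : Measure α}
    {g : α → ℂ} {l : ℝ} (hl : 0 < l) (hg : ∫⁻ x, ENNReal.ofReal (Φ (‖g x‖ / l)) ∂ν ≤ 1) :
    luxNorm Φ ν g ≤ ENNReal.ofReal l :=
  iInf₂_le_of_le l hl (iInf_le_of_le hg le_rfl)

lemma lintegral_le_one_of_hardyNorm_lt {Φ : ℝ → ℝ} (h : IsDoublingConvex Φ) {f : ℂ → ℂ} {l : ℝ}
    (hf : hardyNorm Φ f < ENNReal.ofReal l) {y : ℝ} (hy : 0 < y) :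
    ∫⁻ x : ℝ, ENNReal.ofReal (Φ (‖f (x + y * Complex.I)‖ / l)) ≤ 1 :=
  lintegral_le_one_of_luxNorm_lt h (lt_of_le_of_lt
    (le_iSup₂ (f := fun (y : ℝ) (_ : y ∈ Ioi (0 : ℝ)) =>
      luxNorm Φ (volume : Measure ℝ) (fun x : ℝ => f (x + y * Complex.I))) y hy) hf)

open Filter Topology in
/-- The Carleson condition implies the embedding at the level of modulars. The translates
`f (· + i ε)` are bounded and holomorphic across the real line, so that the Poisson estimate
applies, and Fatou's lemma removes the translation. -/
theorem exists_lintegral_le_of_isCarlesonMeasure {Φ₁ Φ₂ : ℝ → ℝ} (h₁ : IsDoublingConvex Φ₁)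
    (h₂ : IsDoublingConvex Φ₂) (hmono : MonotoneOn (fun t => Φ₂ t / Φ₁ t) (Ioi 0))
    {D : ℝ} (hD0 : 0 ≤ D) (hD : IsDini Φ₁ D) {μ : Measure UpperHalfPlane}
    (hμ : IsCarlesonMeasure (Φ₂ ∘ growthInv Φ₁) μ) :
    ∃ B : ℝ, 1 ≤ B ∧ ∀ (f : ℂ → ℂ) (l : ℝ), 0 < l →
      DifferentiableOn ℂ f {z : ℂ | 0 < z.im} → hardyNorm Φ₁ f < ENNReal.ofReal l →
      ∫⁻ z : UpperHalfPlane, ENNReal.ofReal (Φ₂ (‖f z‖ / l)) ∂μ ≤ ENNReal.ofReal B := by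
  obtain ⟨B, hB, hmain⟩ := exists_lintegral_le_of_poisson h₁ h₂ hmono hD0 hD hμ
  refine ⟨B, hB, fun f l hl hf hnorm => ?_⟩
  have hcf : ContinuousOn f {z : ℂ | 0 < z.im} := hf.continuousOn
  have hmod := fun (y : ℝ) (hy : 0 < y) => lintegral_le_one_of_hardyNorm_lt h₁ hnorm hy
  set ε : ℕ → ℝ := fun n => 1 / ((n : ℝ) + 1) with hε
  have hε0 : ∀ n, 0 < ε n := fun n => by positivity
  have hεlim : Tendsto ε atTop (𝓝 0) := tendsto_one_div_add_atTop_nhds_zero_nat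
  have hcont : ∀ n, Continuous fun z : UpperHalfPlane => f (z + ε n * Complex.I) := fun n =>
    hcf.comp_continuous (by fun_prop) fun z => by
      simpa using add_pos z.im_pos (hε0 n)
  have hbound : ∀ n, ∫⁻ z : UpperHalfPlane,
      ENNReal.ofReal (Φ₂ (‖f (z + ε n * Complex.I)‖ / l)) ∂μ ≤ ENNReal.ofReal B := by
    intro n
    have hcline : Continuous fun t : ℝ => f (t + ε n * Complex.I) :=
      hcf.comp_continuous (by fun_prop) fun t => by simpa using hε0 n
    refine hmain (fun z => ‖f (z + ε n * Complex.I)‖ / l)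
      (fun t => ‖f (t + ε n * Complex.I)‖ / l) ((hcont n).norm.div_const l).measurable
      (fun z => by positivity) (hcline.norm.div_const l).measurable (fun t => by positivity)
      (fun z => ?_) (hmod _ (hε0 n))
    obtain ⟨M, hM⟩ := exists_norm_le_of_lintegral_le h₁ hf hl hmod (hε0 n)
    have hPz := ofReal_norm_le_lintegral_poisson (G := fun w => f (w + ε n * Complex.I))
      (hε0 n) (M := M) (by
        refine hf.comp (by fun_prop) fun w hw => ?_
        simp only [mem_ofPred_eq] at hw ⊢
        simp
        linarith)
      (fun w hw => hM _ (by simpa using hw)) (z := (z : ℂ)) z.im_pos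
    rw [ENNReal.ofReal_div_of_pos hl, div_eq_mul_inv]
    calc _ ≤ _ := mul_le_mul_left hPz _
      _ = _ := by
        rw [← lintegral_mul_const' _ _ (ENNReal.inv_ne_top.2 (by simpa using hl))]
        refine lintegral_congr fun t => ?_
        rw [← div_eq_mul_inv, ← ENNReal.ofReal_div_of_pos hl, mul_div_assoc]
        rfl
  have hlim : ∀ z : UpperHalfPlane, ENNReal.ofReal (Φ₂ (‖f z‖ / l)) =
      liminf (fun n => ENNReal.ofReal (Φ₂ (‖f (z + ε n * Complex.I)‖ / l))) atTop := by
    intro z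
    refine (Tendsto.liminf_eq ?_).symm
    refine ENNReal.tendsto_ofReal ?_
    refine ((h₂.isGrowthFunction.continuousOn (‖f z‖ / l)
      (mem_Ici.2 (by positivity))).tendsto).comp
      (tendsto_nhdsWithin_iff.2 ⟨?_, Eventually.of_forall fun n => mem_Ici.2 (by positivity)⟩)
    have h1 : Tendsto (fun n => (z : ℂ) + ε n * Complex.I) atTop (𝓝 (z : ℂ)) := by
      have h3 : Tendsto (fun n => (z : ℂ) + (ε n : ℂ) * Complex.I) atTop
          (𝓝 ((z : ℂ) + ((0 : ℝ) : ℂ) * Complex.I)) :=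
        (((Complex.continuous_ofReal.tendsto 0).comp hεlim).mul_const _).const_add _
      simpa using h3
    have hzU : {z : ℂ | 0 < z.im} ∈ 𝓝 (z : ℂ) :=
      (isOpen_lt continuous_const Complex.continuous_im).mem_nhds z.im_pos
    exact (((hcf.continuousAt hzU).tendsto.comp h1).norm).div_const l
  simp_rw [hlim]
  refine (lintegral_liminf_le fun n => h₂.isGrowthFunction.measurable_comp
    ((hcont n).norm.div_const l).measurable fun z => by positivity).trans ?_
  exact liminf_le_of_le (by isBoundedDefault) fun b hb =>
    (hb.exists.choose_spec).trans (hbound _)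

/-! ### Test functions -/

open Filter Topology in
lemma hardyNorm_pos {Φ : ℝ → ℝ} (h : IsDoublingConvex Φ) {f : ℂ → ℂ}
    (hf : ContinuousOn f {z : ℂ | 0 < z.im}) {z : ℂ} (hz : 0 < z.im) (hfz : f z ≠ 0) :
    0 < hardyNorm Φ f := by
  rw [pos_iff_ne_zero]
  intro h0
  have hline : Continuous fun x : ℝ => f (x + z.im * Complex.I) :=
    hf.comp_continuous (by fun_prop) fun x => by simpa using hz
  set δ : ℝ := ‖f z‖ / 2 with hδ
  have hfz' : 0 < ‖f z‖ := norm_pos_iff.2 hfz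
  have hδ0 : 0 < δ := by positivity
  set S : Set ℝ := {x : ℝ | δ < ‖f (x + z.im * Complex.I)‖} with hS
  have hSo : IsOpen S := isOpen_lt continuous_const hline.norm
  have hSne : S.Nonempty := ⟨z.re, by
    simp only [hS, mem_ofPred_eq, Complex.re_add_im]
    linarith⟩
  have hm := (hSo.measure_pos volume hSne).ne'
  obtain ⟨n, hn⟩ := ENNReal.exists_nat_mul_gt hm ENNReal.one_ne_top
  have hn0 : (0 : ℝ) < n := by
    rcases Nat.eq_zero_or_pos n with rfl | hn0
    · simp at hn
    · exact_mod_cast hn0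
  have ht := h.growthInv_pos hn0
  have hl : 0 < δ / growthInv Φ n := by positivity
  have hmod := lintegral_le_one_of_hardyNorm_lt h (f := f) (l := δ / growthInv Φ n)
    (by rw [h0]; exact ENNReal.ofReal_pos.2 hl) hz
  refine hn.not_ge (le_trans ?_ hmod)
  calc (n : ENNReal) * volume S = ∫⁻ x in S, (n : ENNReal) := by rw [setLIntegral_const]
    _ ≤ ∫⁻ x in S, ENNReal.ofReal
          (Φ (‖f (x + z.im * Complex.I)‖ / (δ / growthInv Φ n))) := by
        refine setLIntegral_mono' hSo.measurableSet fun x hx => ?_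
        rw [← ENNReal.ofReal_natCast, ← h.map_growthInv hn0.le]
        refine ENNReal.ofReal_le_ofReal (h.mono ht.le ?_)
        rw [h.map_growthInv hn0.le, le_div_iff₀ hl, mul_div_cancel₀ _ ht.ne']
        exact le_of_lt hx
    _ ≤ _ := setLIntegral_le_lintegral _ _

/-- The test function `w ↦ Φ⁻¹(1 / y) · i y / (w - conj z)` attached to `z = x + i y`. It has
positive real part on the upper half-plane, so that sums of test functions do not cancel. -/
def testFunction (Φ : ℝ → ℝ) (z : UpperHalfPlane) (w : ℂ) : ℂ :=
  growthInv Φ (1 / z.im) * (Complex.I * z.im / (w - (starRingEnd ℂ) (z : ℂ)))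

lemma sub_conj_ne_zero (z : UpperHalfPlane) {w : ℂ} (hw : 0 < w.im) :
    w - (starRingEnd ℂ) (z : ℂ) ≠ 0 := by
  intro h0
  have := congrArg Complex.im h0
  simp at this
  linarith [z.im_pos]

lemma differentiableOn_testFunction (Φ : ℝ → ℝ) (z : UpperHalfPlane) :
    DifferentiableOn ℂ (testFunction Φ z) {w : ℂ | 0 < w.im} := by
  unfold testFunction
  exact ((differentiableOn_const _).div (differentiableOn_id.sub_const _)
    fun w hw => sub_conj_ne_zero z hw).const_mul _

lemma norm_testFunction {Φ : ℝ → ℝ} (h : IsDoublingConvex Φ) (z : UpperHalfPlane) (w : ℂ) :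
    ‖testFunction Φ z w‖ =
      growthInv Φ (1 / z.im) * (z.im / ‖w - (starRingEnd ℂ) (z : ℂ)‖) := by
  have h1 := h.growthInv_nonneg (one_div_pos.2 z.im_pos).le
  rw [testFunction, norm_mul, Complex.norm_real, Real.norm_of_nonneg h1]
  simp [abs_of_pos z.im_pos]

/-- The test functions are bounded on each half-plane `{Im ≥ η}`, uniformly in `z`. -/
lemma norm_testFunction_le {Φ : ℝ → ℝ} (h : IsDoublingConvex Φ) (z : UpperHalfPlane) {w : ℂ}
    {η : ℝ} (hη : 0 < η) (hw : η ≤ w.im) : ‖testFunction Φ z w‖ ≤ growthInv Φ (1 / η) := by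
  have hy := z.im_pos
  have h1 := h.growthInv_nonneg (one_div_pos.2 hy).le
  have hge : z.im + η ≤ ‖w - (starRingEnd ℂ) (z : ℂ)‖ := by
    refine le_trans ?_ (Complex.abs_im_le_norm _)
    refine le_trans ?_ (le_abs_self _)
    simp
    linarith
  rw [norm_testFunction h]
  rcases le_total η z.im with hc | hc
  · calc growthInv Φ (1 / z.im) * (z.im / ‖w - (starRingEnd ℂ) (z : ℂ)‖)
        ≤ growthInv Φ (1 / z.im) * 1 := by
          gcongr
          rw [div_le_one (by linarith)]
          linarith
      _ ≤ _ := by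
          rw [mul_one]
          exact h.growthInv_mono (by positivity) (one_div_le_one_div_of_le hη hc)
  · calc growthInv Φ (1 / z.im) * (z.im / ‖w - (starRingEnd ℂ) (z : ℂ)‖)
        ≤ growthInv Φ (1 / z.im) * (z.im / η) := by
          gcongr
          linarith
      _ ≤ growthInv Φ (z.im / η * (1 / z.im)) := by
          rw [mul_comm]
          exact h.mul_growthInv_le (by positivity) ((div_le_one hη).2 hc) (by positivity)
      _ = _ := by
          congr 1
          field_simp

lemma re_testFunction_pos {Φ : ℝ → ℝ} (h : IsDoublingConvex Φ) (z : UpperHalfPlane) {w : ℂ}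
    (hw : 0 < w.im) : 0 < (testFunction Φ z w).re := by
  have hy := z.im_pos
  have h1 := h.growthInv_pos (one_div_pos.2 hy)
  have hne := Complex.normSq_pos.2 (sub_conj_ne_zero z hw)
  rw [testFunction, Complex.re_ofReal_mul, Complex.div_re]
  simp only [Complex.mul_re, Complex.I_re, Complex.I_im, Complex.ofReal_re, Complex.ofReal_im,
    Complex.mul_im, Complex.sub_im, Complex.conj_im, zero_mul, mul_zero, sub_zero, zero_div,
    one_mul, zero_add, sub_neg_eq_add]
  exact mul_pos h1 (div_pos (mul_pos hy (add_pos hw hy)) hne)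

/-- On the Carleson box over an interval `I` the test function attached to a point of height `|I|`
over `I` is comparable to its maximum. -/
lemma le_re_testFunction {Φ : ℝ → ℝ} (h : IsDoublingConvex Φ) {z w : UpperHalfPlane}
    (h1 : |w.re - z.re| ≤ z.im) (h2 : w.im ≤ z.im) :
    growthInv Φ (1 / z.im) / 5 ≤ (testFunction Φ z w).re := by
  have hy := z.im_pos
  have hw := w.im_pos
  have h3 := h.growthInv_pos (one_div_pos.2 hy)
  have hne := Complex.normSq_pos.2 (sub_conj_ne_zero z (w := w) hw)
  rw [testFunction, Complex.re_ofReal_mul, Complex.div_re, div_eq_mul_inv]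
  refine mul_le_mul_of_nonneg_left ?_ h3.le
  have hn : Complex.normSq ((w : ℂ) - (starRingEnd ℂ) (z : ℂ)) =
      (w.re - z.re) ^ 2 + (w.im + z.im) ^ 2 := by
    rw [Complex.normSq_apply]
    simp
    ring
  rw [hn] at hne ⊢
  simp only [Complex.mul_re, Complex.I_re, Complex.I_im, Complex.ofReal_re, Complex.ofReal_im,
    Complex.mul_im, Complex.sub_im, Complex.conj_im, zero_mul, mul_zero, sub_zero, zero_div,
    one_mul, zero_add, sub_neg_eq_add]
  rw [inv_eq_one_div, div_le_div_iff₀ (by norm_num) hne]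
  change 1 * ((w.re - z.re) ^ 2 + (w.im + z.im) ^ 2) ≤ z.im * (w.im + z.im) * 5
  have h4 : (w.re - z.re) ^ 2 ≤ z.im ^ 2 := sq_le_sq' (by linarith [(abs_le.1 h1).1])
    (by linarith [(abs_le.1 h1).2])
  nlinarith

/-- The test functions have Hardy–Orlicz norm at most `4 D`, uniformly in `z`. The Dini
condition is what makes the slowly decaying kernel `1 / (w - conj z)` admissible. -/
lemma lintegral_testFunction_le {Φ : ℝ → ℝ} (h : IsDoublingConvex Φ) {D : ℝ} (hD1 : 1 ≤ D)
    (hD : IsDini Φ D) (z : UpperHalfPlane) {η : ℝ} (hη : 0 < η) :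
    ∫⁻ t : ℝ, ENNReal.ofReal (Φ (‖testFunction Φ z (t + η * Complex.I)‖ / (4 * D))) ≤ 1 := by
  have hy := z.im_pos
  set y := z.im with hy_def
  set x := z.re with hx_def
  set A := growthInv Φ (1 / y) with hA
  have hA0 : 0 < A := h.growthInv_pos (one_div_pos.2 hy)
  have hpt : ∀ t : ℝ, ENNReal.ofReal (Φ (‖testFunction Φ z (t + η * Complex.I)‖ / (4 * D))) ≤
      ∑' k : ℕ, (Metric.closedBall x (2 ^ k * y)).indicator
        (fun _ => ENNReal.ofReal (1 / (2 * D) * Φ ((1 / 2) ^ k * A))) t := by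
    intro t
    have hex : ∃ k : ℕ, |t - x| ≤ 2 ^ k * y := by
      obtain ⟨k, hk⟩ := pow_unbounded_of_one_lt (|t - x| / y) one_lt_two
      exact ⟨k, ((div_lt_iff₀ hy).1 hk).le⟩
    classical
    set k := Nat.find hex with hk
    have hkt : |t - x| ≤ 2 ^ k * y := Nat.find_spec hex
    have hre : |t - x| ≤ ‖(t + η * Complex.I : ℂ) - (starRingEnd ℂ) (z : ℂ)‖ := by
      refine le_trans (le_of_eq ?_) (Complex.abs_re_le_norm _)
      simp [hx_def]
    have him : y ≤ ‖(t + η * Complex.I : ℂ) - (starRingEnd ℂ) (z : ℂ)‖ := by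
      refine le_trans ?_ (Complex.abs_im_le_norm _)
      refine le_trans ?_ (le_abs_self _)
      simp [hy_def]
      linarith
    have hlow : 2 ^ k * y ≤ 2 * ‖(t + η * Complex.I : ℂ) - (starRingEnd ℂ) (z : ℂ)‖ := by
      rcases Nat.eq_zero_or_pos k with h0 | h0
      · rw [h0]
        linarith
      · obtain ⟨j, hj⟩ := Nat.exists_eq_succ_of_ne_zero h0.ne'
        have hmin := Nat.find_min hex (show j < Nat.find hex by lia)
        rw [not_le] at hmin
        rw [hj, Nat.succ_eq_add_one, pow_succ]
        linarith
    refine le_trans ?_ (ENNReal.le_tsum k)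
    rw [indicator_of_mem (by simpa [Real.dist_eq] using hkt)]
    refine ENNReal.ofReal_le_ofReal ?_
    have hnorm : ‖testFunction Φ z (t + η * Complex.I)‖ / (4 * D) ≤
        1 / (2 * D) * ((1 / 2) ^ k * A) := by
      rw [norm_testFunction h, ← hy_def, ← hA]
      have : y / ‖(t + η * Complex.I : ℂ) - (starRingEnd ℂ) (z : ℂ)‖ ≤ 2 * (1 / 2) ^ k := by
        rw [div_le_iff₀ (hy.trans_le him), one_div, inv_pow, mul_right_comm, ← div_eq_mul_inv,
          le_div_iff₀ (by positivity)]
        linarith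
      calc A * (y / ‖(t + η * Complex.I : ℂ) - (starRingEnd ℂ) (z : ℂ)‖) / (4 * D)
          ≤ A * (2 * (1 / 2) ^ k) / (4 * D) := by gcongr
        _ = _ := by field_simp; norm_num
    refine (h.mono (by positivity) hnorm).trans (h.map_mul_le (by positivity) ?_ (by positivity))
    rw [div_le_one (by positivity)]
    linarith
  calc ∫⁻ t : ℝ, ENNReal.ofReal (Φ (‖testFunction Φ z (t + η * Complex.I)‖ / (4 * D)))
      ≤ ∫⁻ t : ℝ, ∑' k : ℕ, (Metric.closedBall x (2 ^ k * y)).indicator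
        (fun _ => ENNReal.ofReal (1 / (2 * D) * Φ ((1 / 2) ^ k * A))) t := lintegral_mono hpt
    _ = ∑' k : ℕ, ENNReal.ofReal (y / D) * ENNReal.ofReal (2 ^ k * Φ ((1 / 2) ^ k * A)) := by
        rw [lintegral_tsum fun k =>
          (measurable_const.indicator measurableSet_closedBall).aemeasurable]
        refine tsum_congr fun k => ?_
        have := h.nonneg (show 0 ≤ (1 / 2) ^ k * A by positivity)
        rw [lintegral_indicator_const measurableSet_closedBall, Real.volume_closedBall,
          ← ENNReal.ofReal_mul (by positivity), ← ENNReal.ofReal_mul (by positivity)]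
        congr 1
        field_simp
    _ ≤ ENNReal.ofReal (y / D) * ENNReal.ofReal (D * Φ A) := by
        rw [ENNReal.tsum_mul_left]
        gcongr
        exact hD A hA0.le
    _ = 1 := by
        rw [hA, h.map_growthInv (by positivity), ← ENNReal.ofReal_mul (by positivity),
          ← ENNReal.ofReal_one]
        congr 1
        field_simp

lemma hardyNorm_le_of_forall_lintegral_le_one {Φ : ℝ → ℝ} {f : ℂ → ℂ} {l : ℝ} (hl : 0 < l)
    (hf : ∀ η : ℝ, 0 < η → ∫⁻ t : ℝ, ENNReal.ofReal (Φ (‖f (t + η * Complex.I)‖ / l)) ≤ 1) :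
    hardyNorm Φ f ≤ ENNReal.ofReal l :=
  iSup₂_le fun η hη => luxNorm_le_of_lintegral_le_one hl (hf η hη)

lemma measurableSet_carlesonSquare {I : Set ℝ} (hI : I.OrdConnected) :
    MeasurableSet (carlesonSquare I) :=
  (hI.measurableSet.preimage UpperHalfPlane.continuous_re.measurable).inter
    (measurableSet_lt UpperHalfPlane.continuous_im.measurable measurable_const)

/-- Every interval of positive length carries a point `z` at height equal to its length, such
that the box over the interval is contained in the box of size `z.im` centred at `z.re`. -/
lemma exists_point_over_interval {I : Set ℝ} (hI : I.OrdConnected) (hb : Bornology.IsBounded I)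
    (h0 : 0 < volume.real I) : ∃ z : UpperHalfPlane, z.im = volume.real I ∧
      ∀ w ∈ carlesonSquare I, |w.re - z.re| ≤ z.im ∧ w.im ≤ z.im := by
  obtain ⟨c, hc⟩ : I.Nonempty := by
    rw [nonempty_iff_ne_empty]
    rintro rfl
    simp at h0
  refine ⟨⟨⟨c, volume.real I⟩, h0⟩, rfl, fun w hw => ⟨?_, hw.2.le⟩⟩
  have hsub : uIcc c w.re ⊆ I := hI.uIcc_subset hc hw.1
  have := measureReal_mono (μ := volume) hsub hb.measure_lt_top.ne
  rw [Measure.real, Real.volume_interval, ENNReal.toReal_ofReal (abs_nonneg _)] at this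
  exact this

/-! ### Series of test functions -/

/-- Superposition of test functions with weights `2⁻¹, 2⁻², …`. By Jensen's inequality it obeys
the same norm bound as the single test functions. -/
def testSeries (Φ : ℝ → ℝ) (z : ℕ → UpperHalfPlane) (w : ℂ) : ℂ :=
  ∑' n, (1 / 2 : ℂ) ^ (n + 1) * testFunction Φ (z n) w

lemma norm_testSeries_term {Φ : ℝ → ℝ} (z : UpperHalfPlane) (w : ℂ) (n : ℕ) :
    ‖(1 / 2 : ℂ) ^ (n + 1) * testFunction Φ z w‖ = (1 / 2) ^ (n + 1) * ‖testFunction Φ z w‖ := by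
  simp

lemma summable_half_pow_succ_mul (c : ℝ) : Summable fun n : ℕ => (1 / 2 : ℝ) ^ (n + 1) * c :=
  ((summable_nat_add_iff 1).2 summable_geometric_two).mul_right c

lemma summable_norm_testSeries {Φ : ℝ → ℝ} (h : IsDoublingConvex Φ) (z : ℕ → UpperHalfPlane)
    {w : ℂ} (hw : 0 < w.im) : Summable fun n => (1 / 2 : ℝ) ^ (n + 1) * ‖testFunction Φ (z n) w‖ :=
  Summable.of_nonneg_of_le (fun n => by positivity)
    (fun n => mul_le_mul_of_nonneg_left (norm_testFunction_le h (z n) hw le_rfl) (by positivity))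
    (summable_half_pow_succ_mul _)

lemma summable_testSeries {Φ : ℝ → ℝ} (h : IsDoublingConvex Φ) (z : ℕ → UpperHalfPlane)
    {w : ℂ} (hw : 0 < w.im) : Summable fun n => (1 / 2 : ℂ) ^ (n + 1) * testFunction Φ (z n) w := by
  refine Summable.of_norm ?_
  simp_rw [norm_testSeries_term]
  exact summable_norm_testSeries h z hw

lemma differentiableOn_testSeries {Φ : ℝ → ℝ} (h : IsDoublingConvex Φ) (z : ℕ → UpperHalfPlane) :
    DifferentiableOn ℂ (testSeries Φ z) {w : ℂ | 0 < w.im} := by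
  intro w hw
  have hw0 : 0 < w.im := hw
  have hη : 0 < w.im / 2 := by positivity
  have hopen : IsOpen {v : ℂ | w.im / 2 < v.im} := isOpen_lt continuous_const Complex.continuous_im
  have hd : DifferentiableOn ℂ (testSeries Φ z) {v : ℂ | w.im / 2 < v.im} := by
    refine Complex.differentiableOn_tsum_of_summable_norm
      (summable_half_pow_succ_mul (growthInv Φ (1 / (w.im / 2)))) (fun n => ?_) hopen
      fun n v hv => ?_
    · exact ((differentiableOn_testFunction Φ (z n)).mono fun v hv => hη.trans hv).const_mul _
    · rw [norm_testSeries_term]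
      exact mul_le_mul_of_nonneg_left (norm_testFunction_le h (z n) hη (le_of_lt hv))
        (by positivity)
  exact (hd.differentiableAt (hopen.mem_nhds (half_lt_self hw0))).differentiableWithinAt

/-- The terms have positive real part, so the sum dominates each of them. -/
lemma mul_re_testFunction_le_norm_testSeries {Φ : ℝ → ℝ} (h : IsDoublingConvex Φ)
    (z : ℕ → UpperHalfPlane) {w : ℂ} (hw : 0 < w.im) (n : ℕ) :
    (1 / 2) ^ (n + 1) * (testFunction Φ (z n) w).re ≤ ‖testSeries Φ z w‖ := by
  have hre : ∀ m, ((1 / 2 : ℂ) ^ (m + 1) * testFunction Φ (z m) w).re =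
      (1 / 2 : ℝ) ^ (m + 1) * (testFunction Φ (z m) w).re := fun m => by
    rw [← Complex.re_ofReal_mul]
    push_cast
    rfl
  have hs := Complex.hasSum_re (summable_testSeries h z hw).hasSum
  simp only [hre] at hs
  refine le_trans ?_ (Complex.re_le_norm _)
  exact le_hasSum hs n fun m _ => mul_nonneg (by positivity) (re_testFunction_pos h (z m) hw).le

lemma hardyNorm_testSeries_le {Φ : ℝ → ℝ} (h : IsDoublingConvex Φ) {D : ℝ} (hD1 : 1 ≤ D)
    (hD : IsDini Φ D) (z : ℕ → UpperHalfPlane) :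
    hardyNorm Φ (testSeries Φ z) ≤ ENNReal.ofReal (4 * D) := by
  refine hardyNorm_le_of_forall_lintegral_le_one (by linarith) fun η hη => ?_
  have him : ∀ t : ℝ, 0 < (t + η * Complex.I : ℂ).im := fun t => by simpa using hη
  calc ∫⁻ t : ℝ, ENNReal.ofReal (Φ (‖testSeries Φ z (t + η * Complex.I)‖ / (4 * D)))
      ≤ ∫⁻ t : ℝ, ∑' n, ENNReal.ofReal ((1 / 2) ^ (n + 1)) *
          ENNReal.ofReal (Φ (‖testFunction Φ (z n) (t + η * Complex.I)‖ / (4 * D))) := by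
        refine lintegral_mono fun t => ?_
        have hs := (summable_norm_testSeries h z (him t)).div_const (4 * D)
        simp_rw [mul_div_assoc] at hs
        refine le_trans (ENNReal.ofReal_le_ofReal (h.mono (by positivity) ?_))
          (h.map_tsum_le (fun n => by positivity) hs)
        simp_rw [← mul_div_assoc]
        rw [tsum_div_const]
        gcongr
        have hn : Summable fun n =>
            ‖(1 / 2 : ℂ) ^ (n + 1) * testFunction Φ (z n) (t + η * Complex.I)‖ := by
          simp_rw [norm_testSeries_term]
          exact summable_norm_testSeries h z (him t)
        refine (norm_tsum_le_tsum_norm hn).trans_eq ?_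
        simp_rw [norm_testSeries_term]
    _ = ∑' n, ENNReal.ofReal ((1 / 2) ^ (n + 1)) * ∫⁻ t : ℝ,
          ENNReal.ofReal (Φ (‖testFunction Φ (z n) (t + η * Complex.I)‖ / (4 * D))) := by
        have hm : ∀ n, Measurable fun t : ℝ =>
            ENNReal.ofReal (Φ (‖testFunction Φ (z n) (t + η * Complex.I)‖ / (4 * D))) := by
          intro n
          refine h.isGrowthFunction.measurable_comp (Measurable.div_const ?_ _)
            fun t => by positivity
          exact ((differentiableOn_testFunction Φ (z n)).continuousOn.comp_continuous
            (by fun_prop) him).norm.measurable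
        rw [lintegral_tsum fun n => ((hm n).const_mul _).aemeasurable]
        exact tsum_congr fun n => lintegral_const_mul _ (hm n)
    _ ≤ ∑' n : ℕ, ENNReal.ofReal ((1 / 2) ^ (n + 1)) := ENNReal.tsum_le_tsum fun n =>
        mul_le_of_le_one_right' (lintegral_testFunction_le h hD1 hD (z n) hη)
    _ = 1 := by
        rw [← ENNReal.ofReal_tsum_of_nonneg (fun n => by positivity)
          ((summable_nat_add_iff 1).2 summable_geometric_two)]
        simp_rw [pow_succ]
        rw [tsum_mul_right, tsum_geometric_two]
        norm_num

/-! ### The implications -/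

/-- Bounded test integrals imply the Carleson condition. -/
theorem isCarlesonMeasure_of_iSup_le {Φ₁ Φ₂ : ℝ → ℝ} (h₁ : IsDoublingConvex Φ₁)
    (h₂ : IsDoublingConvex Φ₂) {μ : Measure UpperHalfPlane} {C : ℝ} (hC : 0 < C)
    (hb : (⨆ z : UpperHalfPlane, ∫⁻ w : UpperHalfPlane,
      ENNReal.ofReal (Φ₂ (growthInv Φ₁ (1 / z.im) *
        (z.im ^ 2 / ‖(z : ℂ) - (starRingEnd ℂ) (w : ℂ)‖ ^ 2))) ∂μ) ≤ ENNReal.ofReal C) :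
    IsCarlesonMeasure (Φ₂ ∘ growthInv Φ₁) μ := by
  obtain ⟨E, hE1, hE⟩ := h₂.exists_map_mul_le 5 (by norm_num)
  refine ⟨C * E, by positivity, fun I hI hIb hI0 => ?_⟩
  obtain ⟨z, hz, hbox⟩ := exists_point_over_interval hI hIb hI0
  rw [← hz, Function.comp_apply]
  have hy := z.im_pos
  set A := growthInv Φ₁ (1 / z.im) with hA
  have hA0 : 0 < A := h₁.growthInv_pos (one_div_pos.2 hy)
  have hp := h₂.pos hA0
  have hp5 := h₂.pos (show 0 < A / 5 by positivity)
  have hE5 : Φ₂ A ≤ E * Φ₂ (A / 5) := by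
    have := hE (A / 5) (by positivity)
    rwa [mul_div_cancel₀ _ (by norm_num)] at this
  have hlow : ENNReal.ofReal (Φ₂ (A / 5)) * μ (carlesonSquare I) ≤ ENNReal.ofReal C := by
    refine le_trans ?_ ((le_iSup _ z).trans hb)
    rw [← setLIntegral_const]
    refine le_trans ?_ (setLIntegral_le_lintegral (carlesonSquare I) _)
    refine setLIntegral_mono' (measurableSet_carlesonSquare hI) fun w hw => ?_
    obtain ⟨hw1, hw2⟩ := hbox w hw
    refine ENNReal.ofReal_le_ofReal (h₂.mono (by positivity) ?_)
    rw [← hA, div_eq_mul_inv]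
    refine mul_le_mul_of_nonneg_left ?_ hA0.le
    have hn : ‖(z : ℂ) - (starRingEnd ℂ) (w : ℂ)‖ ^ 2 =
        (w.re - z.re) ^ 2 + (w.im + z.im) ^ 2 := by
      rw [← Complex.normSq_eq_norm_sq, Complex.normSq_apply]
      simp
      ring
    have hw0 := w.im_pos
    rw [hn, inv_eq_one_div, div_le_div_iff₀ (by norm_num) (by positivity)]
    have h4 : (w.re - z.re) ^ 2 ≤ z.im ^ 2 := sq_le_sq' (by linarith [(abs_le.1 hw1).1])
      (by linarith [(abs_le.1 hw1).2])
    nlinarith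
  calc μ (carlesonSquare I) ≤ ENNReal.ofReal C / ENNReal.ofReal (Φ₂ (A / 5)) := by
        rw [ENNReal.le_div_iff_mul_le (Or.inl (ENNReal.ofReal_pos.2 hp5).ne')
          (Or.inl ENNReal.ofReal_ne_top), mul_comm]
        exact hlow
    _ = ENNReal.ofReal (C / Φ₂ (A / 5)) := (ENNReal.ofReal_div_of_pos hp5).symm
    _ ≤ ENNReal.ofReal (C * E / Φ₂ A) := by
        refine ENNReal.ofReal_le_ofReal ?_
        rw [div_le_div_iff₀ hp5 hp]
        nlinarith

/-- Finiteness of all modulars implies the Carleson condition. If it fails, choose intervals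
`I n` violating it with rapidly growing constants; the modular of the corresponding series of test
functions is at least its integral over each box, hence infinite. -/
theorem isCarlesonMeasure_of_forall_lintegral_lt_top {Φ₁ Φ₂ : ℝ → ℝ} (h₁ : IsDoublingConvex Φ₁)
    (h₂ : IsDoublingConvex Φ₂) {D : ℝ} (hD1 : 1 ≤ D) (hD : IsDini Φ₁ D)
    {μ : Measure UpperHalfPlane} {K : ℝ} (hK : 0 < K)
    (hc : ∀ f : ℂ → ℂ, MemHardyOrlicz Φ₁ f → (∃ z : UpperHalfPlane, f z ≠ 0) →
      ∫⁻ z : UpperHalfPlane,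
        ENNReal.ofReal (Φ₂ (‖f z‖ / (K * (hardyNorm Φ₁ f).toReal))) ∂μ < ⊤) :
    IsCarlesonMeasure (Φ₂ ∘ growthInv Φ₁) μ := by
  by_contra hcon
  simp only [IsCarlesonMeasure, not_exists, not_and, not_forall, not_le] at hcon
  -- `5` is lost on the box, `2 ^ (n + 1)` to the weight, `K * (4 * D)` to dilation and norm
  choose E hE1 hE using fun n : ℕ =>
    h₂.exists_map_mul_le (5 * 2 ^ (n + 1) * (K * (4 * D))) (by positivity)
  choose I hI hIb hI0 hlarge using fun n : ℕ => hcon ((n + 1) * E n)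
    (mul_pos (by positivity) (zero_lt_one.trans_le (hE1 n)))
  choose z hz hbox using fun n : ℕ => exists_point_over_interval (hI n) (hIb n) (hI0 n)
  set f := testSeries Φ₁ z with hf
  have hfd : DifferentiableOn ℂ f {w : ℂ | 0 < w.im} := differentiableOn_testSeries h₁ z
  have hfn : hardyNorm Φ₁ f ≤ ENNReal.ofReal (4 * D) := hardyNorm_testSeries_le h₁ hD1 hD z
  have hfne : f (z 0) ≠ 0 := by
    have h1 := mul_re_testFunction_le_norm_testSeries h₁ z (z 0).im_pos 0
    have h2 := re_testFunction_pos h₁ (z 0) (z 0).im_pos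
    have h3 : 0 < ‖f (z 0)‖ := lt_of_lt_of_le (by positivity) h1
    exact norm_pos_iff.1 h3
  have hpos := hardyNorm_pos h₁ hfd.continuousOn (z 0).im_pos hfne
  have hfin : hardyNorm Φ₁ f < ⊤ := hfn.trans_lt ENNReal.ofReal_lt_top
  have hN0 : 0 < (hardyNorm Φ₁ f).toReal := ENNReal.toReal_pos hpos.ne' hfin.ne
  have hN1 : (hardyNorm Φ₁ f).toReal ≤ 4 * D :=
    ENNReal.toReal_le_of_le_ofReal (by linarith) hfn
  refine (hc f ⟨hfd, hfin⟩ ⟨z 0, hfne⟩).ne (ENNReal.eq_top_of_forall_nnreal_le fun r => ?_)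
  obtain ⟨n, hn⟩ := exists_nat_ge r
  have hy := (z n).im_pos
  set A := growthInv Φ₁ (1 / (z n).im) with hA
  have hA0 : 0 < A := h₁.growthInv_pos (one_div_pos.2 hy)
  have hp := h₂.pos hA0
  set R : ℝ := 5 * 2 ^ (n + 1) * (K * (4 * D)) with hR
  have hR0 : 0 < R := by positivity
  have hEn : Φ₂ A ≤ E n * Φ₂ (A / R) := by
    have := hE n (A / R) (by positivity)
    rwa [← hR, mul_div_cancel₀ _ hR0.ne'] at this
  have hE0 : 0 < E n := zero_lt_one.trans_le (hE1 n)
  have hmu := (hlarge n).le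
  rw [← hz n, Function.comp_apply, ← hA] at hmu
  calc (r : ENNReal) ≤ ENNReal.ofReal (n + 1) := by
        rw [← ENNReal.ofReal_coe_nnreal]
        refine ENNReal.ofReal_le_ofReal ?_
        have : (r : ℝ) ≤ n := by exact_mod_cast hn
        linarith
    _ ≤ ENNReal.ofReal (Φ₂ (A / R)) * ENNReal.ofReal ((n + 1) * E n / Φ₂ A) := by
        have := h₂.nonneg (show 0 ≤ A / R by positivity)
        rw [← ENNReal.ofReal_mul this]
        refine ENNReal.ofReal_le_ofReal ?_
        rw [mul_div_assoc', le_div_iff₀ hp]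
        calc ((n : ℝ) + 1) * Φ₂ A ≤ (n + 1) * (E n * Φ₂ (A / R)) := by gcongr
          _ = _ := by ring
    _ ≤ ENNReal.ofReal (Φ₂ (A / R)) * μ (carlesonSquare (I n)) := by gcongr
    _ = ∫⁻ _ in carlesonSquare (I n), ENNReal.ofReal (Φ₂ (A / R)) ∂μ := by rw [setLIntegral_const]
    _ ≤ ∫⁻ w in carlesonSquare (I n),
          ENNReal.ofReal (Φ₂ (‖f w‖ / (K * (hardyNorm Φ₁ f).toReal))) ∂μ := by
        refine setLIntegral_mono' (measurableSet_carlesonSquare (hI n)) fun w hw => ?_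
        obtain ⟨hw1, hw2⟩ := hbox n w hw
        refine ENNReal.ofReal_le_ofReal (h₂.mono (by positivity) ?_)
        have h3 := mul_re_testFunction_le_norm_testSeries h₁ z w.im_pos n
        have h4 := le_re_testFunction h₁ hw1 hw2
        calc A / R = (1 / 2) ^ (n + 1) * (A / 5) / (K * (4 * D)) := by
              rw [hR, one_div, inv_pow]
              field_simp
          _ ≤ ‖f w‖ / (K * (4 * D)) := by
              gcongr
              exact (mul_le_mul_of_nonneg_left h4 (by positivity)).trans h3
          _ ≤ _ := by gcongr
    _ ≤ _ := setLIntegral_le_lintegral _ _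

/-- The continuous embedding implies that the test integrals are bounded. -/
theorem exists_iSup_le_of_luxNorm_le {Φ₁ Φ₂ : ℝ → ℝ} (h₁ : IsDoublingConvex Φ₁)
    (h₂ : IsDoublingConvex Φ₂) {D : ℝ} (hD1 : 1 ≤ D) (hD : IsDini Φ₁ D)
    {μ : Measure UpperHalfPlane} {K : ℝ} (hK : 0 < K)
    (hd : ∀ f : ℂ → ℂ, MemHardyOrlicz Φ₁ f →
      luxNorm Φ₂ μ (fun z : UpperHalfPlane => f z) ≤ ENNReal.ofReal K * hardyNorm Φ₁ f) :
    ∃ C : ℝ, 0 < C ∧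
      (⨆ z : UpperHalfPlane, ∫⁻ w : UpperHalfPlane,
        ENNReal.ofReal (Φ₂ (growthInv Φ₁ (1 / z.im) *
          (z.im ^ 2 / ‖(z : ℂ) - (starRingEnd ℂ) (w : ℂ)‖ ^ 2))) ∂μ) ≤ ENNReal.ofReal C := by
  set R : ℝ := K * (4 * D) + 1 with hR
  have hR0 : 0 < R := by positivity
  obtain ⟨C, hC1, hC⟩ := h₂.exists_map_mul_le R hR0.le
  have hC0 : 0 < C := zero_lt_one.trans_le hC1
  refine ⟨C, hC0, iSup_le fun z => ?_⟩
  have hfn : hardyNorm Φ₁ (testFunction Φ₁ z) ≤ ENNReal.ofReal (4 * D) :=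
    hardyNorm_le_of_forall_lintegral_le_one (by linarith) fun η hη =>
      lintegral_testFunction_le h₁ hD1 hD z hη
  have hlux : luxNorm Φ₂ μ (fun w : UpperHalfPlane => testFunction Φ₁ z w) < ENNReal.ofReal R := by
    refine (hd _ ⟨differentiableOn_testFunction Φ₁ z, hfn.trans_lt ENNReal.ofReal_lt_top⟩).trans_lt
      ((mul_le_mul_right hfn _).trans_lt ?_)
    rw [← ENNReal.ofReal_mul hK.le, ENNReal.ofReal_lt_ofReal_iff hR0]
    linarith
  have hmod := lintegral_le_one_of_luxNorm_lt h₂ hlux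
  calc ∫⁻ w : UpperHalfPlane, ENNReal.ofReal (Φ₂ (growthInv Φ₁ (1 / z.im) *
          (z.im ^ 2 / ‖(z : ℂ) - (starRingEnd ℂ) (w : ℂ)‖ ^ 2))) ∂μ
      ≤ ∫⁻ w : UpperHalfPlane, ENNReal.ofReal C *
          ENNReal.ofReal (Φ₂ (‖testFunction Φ₁ z w‖ / R)) ∂μ := by
        refine lintegral_mono fun w => ?_
        have hy := z.im_pos
        have hA0 := h₁.growthInv_pos (one_div_pos.2 hy)
        rw [← ENNReal.ofReal_mul hC0.le]
        refine ENNReal.ofReal_le_ofReal (le_trans (h₂.mono (by positivity) ?_)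
          (hC _ (by positivity)))
        rw [mul_div_cancel₀ _ hR0.ne', norm_testFunction h₁]
        have hconj : ‖(z : ℂ) - (starRingEnd ℂ) (w : ℂ)‖ =
            ‖(w : ℂ) - (starRingEnd ℂ) (z : ℂ)‖ := by
          rw [← Complex.norm_conj, map_sub, Complex.conj_conj, norm_sub_rev]
        have him : z.im ≤ ‖(w : ℂ) - (starRingEnd ℂ) (z : ℂ)‖ := by
          refine le_trans ?_ (Complex.abs_im_le_norm _)
          refine le_trans ?_ (le_abs_self _)
          simp [w.im_pos.le]
        have hq := div_le_one_of_le₀ him (norm_nonneg _)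
        rw [hconj, ← div_pow]
        gcongr
        rw [sq]
        exact mul_le_of_le_one_left (by positivity) hq
    _ ≤ ENNReal.ofReal C := by
        rw [lintegral_const_mul' _ _ ENNReal.ofReal_ne_top]
        exact mul_le_of_le_one_right' hmod

/-- The modular estimate gives the norm estimate: by convexity `Φ (u / B) ≤ Φ u / B`. -/
theorem exists_luxNorm_le_of_isCarlesonMeasure {Φ₁ Φ₂ : ℝ → ℝ} (h₁ : IsDoublingConvex Φ₁)
    (h₂ : IsDoublingConvex Φ₂) (hmono : MonotoneOn (fun t => Φ₂ t / Φ₁ t) (Ioi 0))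
    {D : ℝ} (hD0 : 0 ≤ D) (hD : IsDini Φ₁ D) {μ : Measure UpperHalfPlane}
    (hμ : IsCarlesonMeasure (Φ₂ ∘ growthInv Φ₁) μ) :
    ∃ K : ℝ, 0 < K ∧ ∀ f : ℂ → ℂ, MemHardyOrlicz Φ₁ f →
      luxNorm Φ₂ μ (fun z : UpperHalfPlane => f z) ≤ ENNReal.ofReal K * hardyNorm Φ₁ f := by
  obtain ⟨B, hB, hmod⟩ := exists_lintegral_le_of_isCarlesonMeasure h₁ h₂ hmono hD0 hD hμ
  have hB0 : 0 < B := zero_lt_one.trans_le hB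
  refine ⟨B, hB0, fun f hf => ?_⟩
  have hlux : ∀ l : ℝ, 0 < l → hardyNorm Φ₁ f < ENNReal.ofReal l →
      luxNorm Φ₂ μ (fun z : UpperHalfPlane => f z) ≤ ENNReal.ofReal (B * l) := by
    intro l hl hfl
    refine luxNorm_le_of_lintegral_le_one (by positivity) ?_
    calc ∫⁻ z : UpperHalfPlane, ENNReal.ofReal (Φ₂ (‖f z‖ / (B * l))) ∂μ
        ≤ ∫⁻ z : UpperHalfPlane, ENNReal.ofReal B⁻¹ * ENNReal.ofReal (Φ₂ (‖f z‖ / l)) ∂μ := by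
          refine lintegral_mono fun z => ?_
          rw [← ENNReal.ofReal_mul (by positivity)]
          refine ENNReal.ofReal_le_ofReal ?_
          have := h₂.map_mul_le (inv_nonneg.2 hB0.le) (inv_le_one_of_one_le₀ hB)
            (show 0 ≤ ‖f z‖ / l by positivity)
          rwa [inv_mul_eq_div, div_div, mul_comm l B] at this
      _ ≤ ENNReal.ofReal B⁻¹ * ENNReal.ofReal B := by
          rw [lintegral_const_mul' _ _ ENNReal.ofReal_ne_top]
          gcongr
          exact hmod f l hl hf.1 hfl
      _ = 1 := by rw [← ENNReal.ofReal_mul (by positivity), inv_mul_cancel₀ hB0.ne',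
          ENNReal.ofReal_one]
  -- let `l` decrease to the Hardy norm
  have hlim : ∀ δ : ℝ, 0 < δ → luxNorm Φ₂ μ (fun z : UpperHalfPlane => f z) ≤
      ENNReal.ofReal B * hardyNorm Φ₁ f + ENNReal.ofReal δ := by
    intro δ hδ
    have hN := ENNReal.ofReal_toReal hf.2.ne
    have hN0 : 0 ≤ (hardyNorm Φ₁ f).toReal := ENNReal.toReal_nonneg
    have := hlux ((hardyNorm Φ₁ f).toReal + δ / B) (by positivity) (by
      rw [← hN, ENNReal.toReal_ofReal hN0, ENNReal.ofReal_lt_ofReal_iff (by positivity)]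
      have : 0 < δ / B := by positivity
      linarith)
    rw [mul_add, mul_div_cancel₀ _ hB0.ne', ENNReal.ofReal_add (by positivity) hδ.le,
      ENNReal.ofReal_mul hB0.le, hN] at this
    exact this
  refine ENNReal.le_of_forall_pos_le_add fun δ hδ _ => ?_
  have := hlim δ (by exact_mod_cast hδ)
  rwa [ENNReal.ofReal_coe_nnreal] at this

/-- The continuous embedding implies finiteness of the modulars, with twice its norm as dilation
constant. -/
theorem lintegral_lt_top_of_luxNorm_le {Φ₁ Φ₂ : ℝ → ℝ} (h₁ : IsDoublingConvex Φ₁)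
    (h₂ : IsDoublingConvex Φ₂) {μ : Measure UpperHalfPlane} {K : ℝ} (hK : 0 < K) {f : ℂ → ℂ}
    (hf : MemHardyOrlicz Φ₁ f) (hne : ∃ z : UpperHalfPlane, f z ≠ 0)
    (hd : luxNorm Φ₂ μ (fun z : UpperHalfPlane => f z) ≤ ENNReal.ofReal K * hardyNorm Φ₁ f) :
    ∫⁻ z : UpperHalfPlane,
      ENNReal.ofReal (Φ₂ (‖f z‖ / (2 * K * (hardyNorm Φ₁ f).toReal))) ∂μ < ⊤ := by
  obtain ⟨z, hz⟩ := hne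
  have hN0 := ENNReal.toReal_pos (hardyNorm_pos h₁ hf.1.continuousOn z.im_pos hz).ne' hf.2.ne
  refine (lintegral_le_one_of_luxNorm_lt h₂ (hd.trans_lt ?_)).trans_lt ENNReal.one_lt_top
  rw [ENNReal.ofReal_mul (by positivity), ENNReal.ofReal_toReal hf.2.ne]
  refine ENNReal.mul_lt_mul_left
    (hardyNorm_pos h₁ hf.1.continuousOn z.im_pos hz).ne' hf.2.ne ?_
  rw [ENNReal.ofReal_lt_ofReal_iff (by positivity)]
  linarith

end

theorem theorem2p2 (Φ₁ Φ₂ : ℝ → ℝ)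
    (hΦ₁ : IsC1ConvexGrowthFunction Φ₁) (hΦ₂ : IsC1ConvexGrowthFunction Φ₂)
    (hU : IsClassU Φ₂) (hNabla : NablaTwo Φ₁)
    (hmono : MonotoneOn (fun t => Φ₂ t / Φ₁ t) (Ioi 0))
    (μ : Measure UpperHalfPlane) :
    List.TFAE [
      -- (a) Carleson condition
      IsCarlesonMeasure (Φ₂ ∘ growthInv Φ₁) μ,
      -- (b) uniformly bounded test integrals
      ∃ C : ℝ, 0 < C ∧
        (⨆ z : UpperHalfPlane, ∫⁻ w : UpperHalfPlane,
          ENNReal.ofReal (Φ₂ (growthInv Φ₁ (1 / z.im) *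
            (z.im ^ 2 / ‖(z : ℂ) - (starRingEnd ℂ) (w : ℂ)‖ ^ 2))) ∂μ) ≤ ENNReal.ofReal C,
      -- (c) finiteness of the modular, with one dilation constant for all functions
      ∃ K : ℝ, 0 < K ∧ ∀ f : ℂ → ℂ, MemHardyOrlicz Φ₁ f → (∃ z : UpperHalfPlane, f z ≠ 0) →
        ∫⁻ z : UpperHalfPlane,
          ENNReal.ofReal (Φ₂ (‖f z‖ / (K * (hardyNorm Φ₁ f).toReal))) ∂μ < ⊤,
      -- (d) continuous embedding, as a bound between the Luxembourg norms
      ∃ K : ℝ, 0 < K ∧ ∀ f : ℂ → ℂ, MemHardyOrlicz Φ₁ f →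
        luxNorm Φ₂ μ (fun z : UpperHalfPlane => f z) ≤ ENNReal.ofReal K * hardyNorm Φ₁ f] := by
  have h₁ := hΦ₁.isDoublingConvex_of_nablaTwo hNabla
  have h₂ := hΦ₂.isDoublingConvex_of_isClassU hU
  obtain ⟨D, hD1, hD⟩ := exists_isDini h₁ hNabla.2
  tfae_have 1 → 4 := fun h =>
    exists_luxNorm_le_of_isCarlesonMeasure h₁ h₂ hmono (zero_le_one.trans hD1) hD h
  tfae_have 4 → 2 := fun ⟨_, hK, hd⟩ => exists_iSup_le_of_luxNorm_le h₁ h₂ hD1 hD hK hd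
  tfae_have 2 → 1 := fun ⟨_, hC, hb⟩ => isCarlesonMeasure_of_iSup_le h₁ h₂ hC hb
  tfae_have 4 → 3 := fun ⟨K, hK, hd⟩ => ⟨2 * K, by positivity, fun f hf hne =>
    lintegral_lt_top_of_luxNorm_le h₁ h₂ hK hf hne (hd f hf)⟩
  tfae_have 3 → 1 := fun ⟨_, hK, hc⟩ =>
    isCarlesonMeasure_of_forall_lintegral_lt_top h₁ h₂ hD1 hD hK hc
  tfae_finish
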